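/- Let $\rho\in\mathbb{R}$, $\sigma,c\in(0,\infty)$ and let $\eta_1$ be a probability measure on $\mathbb{R}$. Let $M(z,\mathrm{d}x)=\mathcal{N}(\rho z,\sigma^2)$, $G(x)=e^{-cx^2/2}$ and $Q(z,\mathrm{d}x)=M(z,\mathrm{d}x)G(x)$, and let $$\hat\eta_1(\mathrm{d}x)=\frac{G(x)\eta_1(\mathrm{d}x)}{\eta_1(G)},\qquad \hat\eta_t=\frac{\hat\eta_1Q^{t-1}}{\hat\eta_1Q^{t-1}(\mathbb{R})},\qquad \eta_t=\hat\eta_{t-1}M,\qquad t\ge 2,$$ be the filtering distributions $\hat\eta_t$ and the predictive distributions $\eta_t$ of the model $X_1\sim\eta_1$, $X_{t+1}=\rho X_t+\sigma W_{t+1}$, $Y_t=X_t+c^{-1/2}Z_t$ (the $W_{t+1}$'s and $Z_t$'s being independent $\mathcal{N}(0,1)$ variables) with observations $y_t=0$ for all $t\ge 1$. For a probability measure $\pi$ on $\mathbb{R}$ let $F_\pi$ be its cumulative distribution function and $F_\pi^{-1}(p)=\inf\{x: p\le F_\pi(x)\}$ for $p\in(0,1)$, and let $\|\pi_1-\pi_2\|=\sup_{a\in\mathbb{R}}|F_{\pi_1}(a)-F_{\pi_2}(a)|$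 be the Kolmogorov distance. A sequence $(u^n)_{n\ge1}$ of points of $[0,1)^2$ is a $(0,2)$-sequence in base $2$ if, for all integers $k,m\ge 0$, every box $\prod_{j=1}^2[a_j2^{-d_j},(a_j+1)2^{-d_j})$ with integers $d_j\ge0$, $0\le a_j<2^{d_j}$ and $d_1+d_2=m$ contains exactly one of the points $u^n$, $k2^m<n\le(k+1)2^m$. A scrambled $(0,2)$-sequence in base $2$ is a sequence of $(0,1)^2$-valued random variables, each of them uniformly distributed on $(0,1)^2$, which is almost surely a $(0,2)$-sequence in base $2$. Given $N\ge1$ and, for each $t\ge 1$, the first $N$ points $U_t^n=(U_{t,1}^n,U_{t,2}^n)$, $n=1,\dots,N$, of a scrambled $(0,2)$-sequence in base $2$ (all defined on one probability space; independence between different $t$ is not assumed), the sequential quasi-Monte Carlo (SQMC) algorithm sets $X_1^n=F_{\eta_1}^{-1}(U_{1,1}^n)$ and, for $t\ge2$, $\hat X_{t-1}^n=F^{-1}_{\hat\eta^N_{t-1}}(U^n_{t,1})$ and $X_t^n=F^{-1}_{M(\hat X_{t-1}^n,\mathrm{d}x)}(U_{t,2}^n)$, where for all $t\ge1$ $$\eta_t^N=\frac1N\sum_{n=1}^N\delta_{X_t^n},\qquad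 \hat\eta_t^N=\sum_{n=1}^N W_t^n\delta_{X_t^n},\qquad W_t^n=\frac{G(X_t^n)}{\sum_{m=1}^NG(X_t^m)}.$$ Then there exists a constant $\bar C_2'\in(0,\infty)$, depending only on $\rho,\sigma,c$ and $\eta_1$ (in particular not on $N$, on $\kappa$ or on the random points), such that for every $N\ge 1$ and every $\kappa\in(0,1)$, $$\frac{N}{\log(1+N)^2}\ \ge\ \bar C_2'\,\{1+\log(1+\kappa^{-1})\}^2\,\kappa^{-2}\ \Longrightarrow\ \mathbb{P}\Big(\sup_{t\ge1}\|\hat\eta_t^N-\hat\eta_t\|\le\kappa,\ \sup_{t\ge1}\|\eta_t^N-\eta_t\|\le\kappa\Big)=1,$$ where $\log(1+N)^2$ means $(\log(1+N))^2$. -/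

import Mathlib

open MeasureTheory ProbabilityTheory
open scoped ENNReal

noncomputable section

namespace SQMC

/-! ### Scrambled `(t, s)`-sequences in base `b`

The points of a sequence are numbered from `0`: `u n` is the `(n + 1)`-st point. -/

/-- The `b`-ary box `∏ⱼ [aⱼ b^(-dⱼ), (aⱼ + 1) b^(-dⱼ))` (used with `aⱼ < b^(dⱼ)`). -/
def baryBox (b : ℕ) {s : ℕ} (a d : Fin s → ℕ) : Set (Fin s → ℝ) :=
  Set.univ.pi fun j => Set.Ico ((a j : ℝ) / (b : ℝ) ^ d j) (((a j : ℝ) + 1) / (b : ℝ) ^ d j)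

/-- `(t, m, s)`-nets in base `b`, for `t ≤ m`: every `b`-ary box of volume `b^(t - m)` contains
exactly `b^t` points, counted with multiplicity. The volume of the box with exponents `d` is
`b ^ (-∑ⱼ dⱼ)`, so that it equals `b^(t - m)` exactly when `t + ∑ⱼ dⱼ = m`. -/
def IsTMSNet (t m s b : ℕ) (u : Fin (b ^ m) → Fin s → ℝ) : Prop :=
  ∀ a d : Fin s → ℕ, (∀ j, a j < b ^ d j) → t + ∑ j, d j = m →
    {n : Fin (b ^ m) | u n ∈ baryBox b a d}.ncard = b ^ t

/-- `(t, s)`-sequences in base `b`: sequences of points of `[0,1)^s` all of whose blocks of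
indices `k b^m ≤ n < (k + 1) b^m`, with `m ≥ t`, are `(t, m, s)`-nets in base `b`. -/
def IsTSSequence (t s b : ℕ) (u : ℕ → Fin s → ℝ) : Prop :=
  (∀ n j, u n j ∈ Set.Ico (0 : ℝ) 1) ∧
    ∀ k m : ℕ, t ≤ m → IsTMSNet t m s b fun n => u (k * b ^ m + n)

/-- Scrambled `(t, s)`-sequences in base `b`: sequences of `(0,1)^s`-valued random variables,
each of them uniformly distributed on `(0,1)^s`, which almost surely form a `(t, s)`-sequence
in base `b`. -/
structure IsScrambledSequence {Ω : Type*} [MeasurableSpace Ω] (P : Measure Ω) (t s b : ℕ)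
    (U : ℕ → Ω → Fin s → ℝ) : Prop where
  measurable : ∀ n, Measurable (U n)
  mem_Ioo : ∀ n ω j, U n ω j ∈ Set.Ioo (0 : ℝ) 1
  law : ∀ n, P.map (U n) = Measure.pi fun _ : Fin s => volume.restrict (Set.Ioo (0 : ℝ) 1)
  ae_isTSSequence : ∀ᵐ ω ∂P, IsTSSequence t s b fun n => U n ω

/-! ### Kolmogorov distance and generalized inverse -/

/-- Kolmogorov distance `sup_a |F_μ(a) - F_ν(a)|` between probability measures on `ℝ`. -/
def kolmogorovDist (μ ν : Measure ℝ) : ℝ := ⨆ a : ℝ, |cdf μ a - cdf ν a|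

/-- Generalized inverse `F_μ⁻¹(p) = inf {x | p ≤ F_μ(x)}` of the cumulative distribution
function, for `p ∈ (0,1)`. -/
def quantile (μ : Measure ℝ) (p : ℝ) : ℝ := sInf {x : ℝ | p ≤ cdf μ x}

/-! ### The model

Times are numbered from `0`: index `t` stands for the `(t + 1)`-st time instant. -/

/-- The Gaussian transition kernel `M(z, dx) = 𝒩(ρ z, σ²)`. -/
def transition (ρ σ : ℝ) : Kernel ℝ ℝ where
  toFun z := gaussianReal (ρ * z) (σ ^ 2).toNNReal
  measurable' := measurable_gaussianReal.comp
    ((measurable_const.mul measurable_id).prodMk measurable_const)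

instance isMarkovKernel_transition (ρ σ : ℝ) : IsMarkovKernel (transition ρ σ) :=
  ⟨fun z => inferInstanceAs (IsProbabilityMeasure (gaussianReal (ρ * z) (σ ^ 2).toNNReal))⟩

/-- The likelihood `G(x) = exp(-c x² / 2)` of the observation `0`. -/
def likelihood (c x : ℝ) : ℝ := Real.exp (-c * x ^ 2 / 2)

/-- The unnormalized kernel `Q(z, dx) = M(z, dx) G(x)`. -/
def unnormKernel (ρ σ c : ℝ) : Kernel ℝ ℝ :=
  (transition ρ σ).withDensity fun _ x => ENNReal.ofReal (likelihood c x)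

/-- The normalization `μ / μ(ℝ)` of a measure `μ` of positive finite mass. -/
def normalizeMeasure (μ : Measure ℝ) : Measure ℝ := (μ Set.univ)⁻¹ • μ

/-- The filtering distribution at the first time instant, `G(x) η₁(dx) / η₁(G)`. -/
def filterInit (c : ℝ) (η₁ : Measure ℝ) : Measure ℝ :=
  normalizeMeasure (η₁.withDensity fun x => ENNReal.ofReal (likelihood c x))

/-- The filtering distributions: index `t` gives `η̂₁ Q^t / η̂₁ Q^t(ℝ)`, the filtering
distribution at the `(t + 1)`-st time instant. -/
def filterDist (ρ σ c : ℝ) (η₁ : Measure ℝ) (t : ℕ) : Measure ℝ :=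
  normalizeMeasure ((filterInit c η₁).bind (unnormKernel ρ σ c ^ t : Kernel ℝ ℝ))

/-- The predictive distributions: `η₁` at the first time instant, and then the image under `M`
of the preceding filtering distribution. -/
def predDist (ρ σ c : ℝ) (η₁ : Measure ℝ) : ℕ → Measure ℝ
  | 0 => η₁
  | t + 1 => (filterDist ρ σ c η₁ t).bind (transition ρ σ)

/-! ### The filtering algorithm -/

/-- The empirical measure `(1/N) ∑ₙ δ_{xₙ}`. -/
def empirical {N : ℕ} (x : Fin N → ℝ) : Measure ℝ :=
  ∑ n, ENNReal.ofReal (1 / N) • Measure.dirac (x n)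

/-- The weighted empirical measure `∑ₙ Wₙ δ_{xₙ}` with `Wₙ = G(xₙ) / ∑ₘ G(xₘ)`. -/
def weightedEmpirical (c : ℝ) {N : ℕ} (x : Fin N → ℝ) : Measure ℝ :=
  ∑ n, ENNReal.ofReal (likelihood c (x n) / ∑ m, likelihood c (x m)) • Measure.dirac (x n)

/-- The particles computed from the point sets `{u t n}ₙ` in `(0,1)²`: initialization by
inversion of the distribution function of `η₁`, then, at each time, resampling from the weighted
empirical measure with the first coordinates (coordinate `0`) and mutation with the second
coordinates (coordinate `1`), both by inversion. -/
def particles (ρ σ c : ℝ) (η₁ : Measure ℝ) {N : ℕ} (u : ℕ → Fin N → Fin 2 → ℝ) :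
    ℕ → Fin N → ℝ
  | 0 => fun n => quantile η₁ (u 0 n 0)
  | t + 1 => fun n =>
      quantile
        (transition ρ σ
          (quantile (weightedEmpirical c (particles ρ σ c η₁ u t)) (u (t + 1) n 0)))
        (u (t + 1) n 1)

/-- The estimates `η_t^N` of the predictive distributions. -/
def predEst (ρ σ c : ℝ) (η₁ : Measure ℝ) {N : ℕ} (u : ℕ → Fin N → Fin 2 → ℝ) (t : ℕ) :
    Measure ℝ :=
  empirical (particles ρ σ c η₁ u t)

/-- The estimates `η̂_t^N` of the filtering distributions. -/
def filterEst (ρ σ c : ℝ) (η₁ : Measure ℝ) {N : ℕ} (u : ℕ → Fin N → Fin 2 → ℝ) (t : ℕ) :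
    Measure ℝ :=
  weightedEmpirical c (particles ρ σ c η₁ u t)

end SQMC

end

noncomputable section

namespace SQMC

/-! ### Discrepancy of `(0, 2)`-sequences with respect to monotone regions -/

/-! The bound is pathwise: it holds whenever all the driving point sequences are (0,2)-sequences,
which is almost sure. It combines a local error estimate with exponential stability of the filter.

Local error. A new particle lies below `a` iff the second coordinate of its point is at most H(first
coordinate), where H(p) is the transition cdf at `a` started from the p-quantile of the weighted
particles. The Gaussian kernel is a location family, so H is monotone, and only the discrepancy over
regions under monotone graphs matters. For a net of 2^m points it is of order 2^(m/2): cut the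
square into columns, count each up to one point, and let the variation of H telescope. Splitting N
in binary sums these errors geometrically, so each step errs by at most 12/√N in Kolmogorov distance
(`IsTSSequence.abs_countBelow_sub_le`, `kolmogorovDist_empirical_transition_le`).

Stability. Up to a constant, G(z) Q^k(z, ·) is a weight exp(-p_k z²/2) times 𝒩(m_k z, v_k), and m_k
decays geometrically whatever ρ is. Integration by parts bounds a difference of integrals by total
variation times Kolmogorov distance, so k steps contract by B θ^k
(`exists_kolmogorovDist_propagate_le`), provided the normalizing integrals stay above some δ.

Uniformity in time. That lower bound is explicit for the exact filter and passes to the particles by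
induction on time, since they are already known to be close to it. The local errors then add up to
at most B/(1-θ) times 12/√N (`exists_kolmogorovDist_propagate_le_of_local`). The logarithms in the
hypothesis only strengthen it. -/

open Finset in
lemma card_filter_lt_dyadic {ι : Type*} (S : Finset ι) (y : ι → ℝ) (d : ℕ)
    (hy : ∀ n ∈ S, 0 ≤ y n)
    (h1 : ∀ j : ℕ, j < 2 ^ d →
      #{n ∈ S | y n ∈ Set.Ico ((j : ℝ) / 2 ^ d) (((j : ℝ) + 1) / 2 ^ d)} = 1) (j : ℕ)
    (hj : j ≤ 2 ^ d) : #{n ∈ S | y n < (j : ℝ) / 2 ^ d} = j := by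
  classical
  induction j with
  | zero =>
    simp only [Nat.cast_zero, zero_div, card_eq_zero, filter_eq_empty_iff, not_lt]
    exact fun n hn => hy n hn
  | succ j ih =>
    have hle : (j : ℝ) / 2 ^ d ≤ ((j : ℝ) + 1) / 2 ^ d := by gcongr; linarith
    have : {n ∈ S | y n < ((j + 1 : ℕ) : ℝ) / 2 ^ d} =
        {n ∈ S | y n < (j : ℝ) / 2 ^ d} ∪
          {n ∈ S | y n ∈ Set.Ico ((j : ℝ) / 2 ^ d) (((j : ℝ) + 1) / 2 ^ d)} := by
      ext n
      simp only [mem_filter, mem_union, Set.mem_Ico, Nat.cast_add, Nat.cast_one]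
      constructor
      · rintro ⟨a, b⟩
        rcases lt_or_ge (y n) ((j : ℝ) / 2 ^ d) with h | h
        · exact Or.inl ⟨a, h⟩
        · exact Or.inr ⟨a, h, b⟩
      · rintro (⟨a, b⟩ | ⟨a, -, b⟩)
        · exact ⟨a, b.trans_le hle⟩
        · exact ⟨a, b⟩
    rw [this, card_union_of_disjoint, ih (by omega), h1 j (by omega)]
    rw [Finset.disjoint_left]
    intro n hn hn'
    simp only [mem_filter, Set.mem_Ico] at hn hn'
    exact absurd hn.2 (not_lt.2 hn'.2.1)

-- Round `lo` down and `hi` up to the grid of mesh 2^(-d), where counts are exact; each rounding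
-- costs at most one point.
open Finset in
lemma card_filter_le_dyadic {ι : Type*} (S : Finset ι) (y : ι → ℝ) (d : ℕ)
    (hy : ∀ n ∈ S, y n ∈ Set.Ico (0 : ℝ) 1)
    (h1 : ∀ j : ℕ, j < 2 ^ d →
      #{n ∈ S | y n ∈ Set.Ico ((j : ℝ) / 2 ^ d) (((j : ℝ) + 1) / 2 ^ d)} = 1)
    (h : ι → ℝ) {lo hi : ℝ} (hlo : 0 ≤ lo) (hhi : hi ≤ 1) (hl : ∀ n ∈ S, lo ≤ h n)
    (hh : ∀ n ∈ S, h n ≤ hi) (hlh : lo ≤ hi) :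
    lo * 2 ^ d - 1 ≤ (#{n ∈ S | y n ≤ h n} : ℝ) ∧
      (#{n ∈ S | y n ≤ h n} : ℝ) ≤ hi * 2 ^ d + 1 := by
  classical
  have key := card_filter_lt_dyadic S y d (fun n hn => (hy n hn).1) h1
  have hpos : (0 : ℝ) < 2 ^ d := by positivity
  have hi0 : 0 ≤ hi * 2 ^ d := by have := hlo.trans hlh; positivity
  have lo0 : 0 ≤ lo * 2 ^ d := by positivity
  constructor
  · have hle : ⌊lo * 2 ^ d⌋₊ ≤ 2 ^ d := by
      apply Nat.floor_le_of_le
      push_cast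
      nlinarith
    have hsub : {n ∈ S | y n < (⌊lo * 2 ^ d⌋₊ : ℝ) / 2 ^ d} ⊆ {n ∈ S | y n ≤ h n} := by
      intro n hn
      simp only [mem_filter] at hn ⊢
      refine ⟨hn.1, hn.2.le.trans (le_trans ?_ (hl n hn.1))⟩
      rw [div_le_iff₀ hpos]
      exact Nat.floor_le lo0
    have h2 := card_le_card hsub
    rw [key _ hle] at h2
    have h3 := Nat.lt_floor_add_one (lo * 2 ^ d)
    have h4 : (⌊lo * 2 ^ d⌋₊ : ℝ) ≤ #{n ∈ S | y n ≤ h n} := by exact_mod_cast h2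
    linarith
  · rcases le_or_gt (⌊hi * 2 ^ d⌋₊ + 1) (2 ^ d) with hle | hgt
    · have hsub : {n ∈ S | y n ≤ h n} ⊆
          {n ∈ S | y n < ((⌊hi * 2 ^ d⌋₊ + 1 : ℕ) : ℝ) / 2 ^ d} := by
        intro n hn
        simp only [mem_filter] at hn ⊢
        refine ⟨hn.1, (hn.2.trans (hh n hn.1)).trans_lt ?_⟩
        rw [lt_div_iff₀ hpos]
        push_cast
        exact Nat.lt_floor_add_one _
      have h2 := card_le_card hsub
      rw [key _ hle] at h2
      have h3 := Nat.floor_le hi0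
      have h4 : (#{n ∈ S | y n ≤ h n} : ℝ) ≤ ⌊hi * 2 ^ d⌋₊ + 1 := by exact_mod_cast h2
      linarith
    -- The rounded-up grid point exceeds 1, so the total count 2^d serves as the bound.
    · have hsub : {n ∈ S | y n ≤ h n} ⊆ {n ∈ S | y n < ((2 ^ d : ℕ) : ℝ) / 2 ^ d} := by
        intro n hn
        simp only [mem_filter] at hn ⊢
        refine ⟨hn.1, ?_⟩
        push_cast
        rw [div_self hpos.ne']
        exact (hy n hn.1).2
      have h2 := card_le_card hsub
      rw [key _ le_rfl] at h2
      have h3 := Nat.floor_le hi0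
      have h4 : (#{n ∈ S | y n ≤ h n} : ℝ) ≤ ⌊hi * 2 ^ d⌋₊ + 1 := by
        have h5 : (#{n ∈ S | y n ≤ h n} : ℝ) ≤ ((⌊hi * 2 ^ d⌋₊ + 1 : ℕ) : ℝ) :=
          Nat.cast_le.2 (h2.trans hgt.le)
        rwa [Nat.cast_add, Nat.cast_one] at h5
      linarith

/-- The number of indices `s ≤ n < s + L` such that `u n` lies below the graph of `h`. -/
def countBelow (u : ℕ → Fin 2 → ℝ) (h : ℝ → ℝ) (s L : ℕ) : ℕ :=
  Finset.card {n ∈ Finset.range L | u (s + n) 1 ≤ h (u (s + n) 0)}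

lemma countBelow_add (u : ℕ → Fin 2 → ℝ) (h : ℝ → ℝ) (s L L' : ℕ) :
    countBelow u h s (L + L') = countBelow u h s L + countBelow u h (s + L) L' := by
  simp only [countBelow, Finset.card_filter, Finset.sum_range_add, add_assoc]

open Finset in
lemma IsTMSNet.card_box {m d e : ℕ} {u : Fin (2 ^ m) → Fin 2 → ℝ} (hu : IsTMSNet 0 m 2 2 u)
    (hde : d + e = m) {i j : ℕ} (hi : i < 2 ^ d) (hj : j < 2 ^ e) :
    #{n | u n 0 ∈ Set.Ico ((i : ℝ) / 2 ^ d) (((i : ℝ) + 1) / 2 ^ d) ∧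
      u n 1 ∈ Set.Ico ((j : ℝ) / 2 ^ e) (((j : ℝ) + 1) / 2 ^ e)} = 1 := by
  classical
  have := hu ![i, j] ![d, e] (by intro l; fin_cases l <;> simpa) (by simpa using hde)
  rw [Set.ncard_eq_toFinset_card', pow_zero] at this
  refine Eq.trans ?_ this
  congr 1
  ext n
  simp [baryBox, Set.mem_pi, Fin.forall_fin_two]

open Finset in
/-- Points of a net below the graph of a function that is pinched between two step functions. -/
lemma IsTMSNet.card_below {m d e : ℕ} {u : Fin (2 ^ m) → Fin 2 → ℝ} (hu : IsTMSNet 0 m 2 2 u)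
    (h01 : ∀ n j, u n j ∈ Set.Ico (0 : ℝ) 1)
    (hde : d + e = m) (h : ℝ → ℝ) (lo hi : ℕ → ℝ) (hlo : ∀ i, 0 ≤ lo i) (hhi : ∀ i, hi i ≤ 1)
    (hlh : ∀ i, lo i ≤ hi i)
    (hl : ∀ n, ∀ i : ℕ, i < 2 ^ d →
      u n 0 ∈ Set.Ico ((i : ℝ) / 2 ^ d) (((i : ℝ) + 1) / 2 ^ d) →
        lo i ≤ h (u n 0) ∧ h (u n 0) ≤ hi i) :
    2 ^ e * ∑ i ∈ range (2 ^ d), lo i - 2 ^ d ≤ (#{n | u n 1 ≤ h (u n 0)} : ℝ) ∧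
      (#{n | u n 1 ≤ h (u n 0)} : ℝ) ≤ 2 ^ e * ∑ i ∈ range (2 ^ d), hi i + 2 ^ d := by
  classical
  let I : ℕ → Set ℝ := fun i => Set.Ico ((i : ℝ) / 2 ^ d) (((i : ℝ) + 1) / 2 ^ d)
  have hd : (0 : ℝ) < 2 ^ d := by positivity
  have hI : ∀ x ∈ Set.Ico (0 : ℝ) 1, ∀ i : ℕ, x ∈ I i ↔ ⌊x * 2 ^ d⌋₊ = i := by
    intro x hx i
    have : 0 ≤ x * 2 ^ d := mul_nonneg hx.1 hd.le
    rw [Nat.floor_eq_iff this]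
    simp only [I, Set.mem_Ico, div_le_iff₀ hd, lt_div_iff₀ hd]
  -- Within one column of width 2^(-d) the net property puts exactly one point in each of the 2^e
  -- cells.
  have hcount : (#{n | u n 1 ≤ h (u n 0)} : ℝ) = ∑ i ∈ range (2 ^ d),
      (#{n ∈ {n | u n 0 ∈ I i} | u n 1 ≤ h (u n 0)} : ℝ) := by
    rw [← Nat.cast_sum]
    congr 1
    rw [Finset.card_eq_sum_card_fiberwise (f := fun n => ⌊u n 0 * 2 ^ d⌋₊) (t := range (2 ^ d))]
    · refine sum_congr rfl fun i _ => ?_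
      rw [filter_filter, filter_filter]
      congr 1
      ext n
      simp only [mem_filter, Finset.mem_univ, true_and, hI _ (h01 n 0)]
      tauto
    · intro n _
      simp only [coe_range, Set.mem_Iio]
      rw [Nat.floor_lt (mul_nonneg (h01 n 0).1 hd.le)]
      push_cast
      nlinarith [(h01 n 0).2]
  have hcol : ∀ i ∈ range (2 ^ d),
      lo i * 2 ^ e - 1 ≤ (#{n ∈ {n | u n 0 ∈ I i} | u n 1 ≤ h (u n 0)} : ℝ) ∧
      (#{n ∈ {n | u n 0 ∈ I i} | u n 1 ≤ h (u n 0)} : ℝ) ≤ hi i * 2 ^ e + 1 := by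
    intro i hi'
    refine card_filter_le_dyadic _ (fun n => u n 1) e (fun n _ => h01 n 1) ?_
      (fun n => h (u n 0)) (hlo i) (hhi i) ?_ ?_ (hlh i)
    · intro j hj
      rw [filter_filter]
      exact hu.card_box hde (mem_range.1 hi') hj
    · intro n hn
      exact (hl n i (mem_range.1 hi') (mem_filter.1 hn).2).1
    · intro n hn
      exact (hl n i (mem_range.1 hi') (mem_filter.1 hn).2).2
  rw [hcount]
  constructor
  · have := sum_le_sum fun i hi' => (hcol i hi').1
    simp only [sum_sub_distrib, sum_const, card_range, ← sum_mul, nsmul_eq_mul] at this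
    push_cast at this
    linarith
  · have := sum_le_sum fun i hi' => (hcol i hi').2
    simp only [sum_add_distrib, sum_const, card_range, ← sum_mul, nsmul_eq_mul] at this
    push_cast at this
    linarith

/-! ### Dyadic Riemann sums of monotone functions and the resulting discrepancy bounds. -/

lemma _root_.Monotone.sum_dyadic_le_integral {H : ℝ → ℝ} (hH : Monotone H) (d : ℕ) :
    ∑ i ∈ Finset.range (2 ^ d), H (i / 2 ^ d) ≤ 2 ^ d * ∫ x in (0 : ℝ)..1, H x ∧
      2 ^ d * ∫ x in (0 : ℝ)..1, H x ≤ ∑ i ∈ Finset.range (2 ^ d), H ((i + 1) / 2 ^ d) := by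
  have hd : (0 : ℝ) < 2 ^ d := by positivity
  have hg : Monotone fun x => H (x / 2 ^ d) := fun x y hxy => hH (by gcongr)
  have hi : ∫ x in (0 : ℝ)..(0 + (2 ^ d : ℕ)), H (x / 2 ^ d) = 2 ^ d * ∫ x in (0 : ℝ)..1, H x := by
    rw [intervalIntegral.integral_comp_div _ hd.ne']
    push_cast
    rw [zero_add, zero_div, div_self hd.ne', smul_eq_mul]
  rw [← hi]
  have h1 := (hg.monotoneOn (Set.Icc (0 : ℝ) (0 + (2 ^ d : ℕ)))).sum_le_integral
  have h2 := (hg.monotoneOn (Set.Icc (0 : ℝ) (0 + (2 ^ d : ℕ)))).integral_le_sum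
  simp only [zero_add, Nat.cast_add, Nat.cast_one] at h1 h2 ⊢
  exact ⟨h1, h2⟩

lemma _root_.Antitone.sum_dyadic_le_integral {H : ℝ → ℝ} (hH : Antitone H) (d : ℕ) :
    ∑ i ∈ Finset.range (2 ^ d), H ((i + 1) / 2 ^ d) ≤ 2 ^ d * ∫ x in (0 : ℝ)..1, H x ∧
      2 ^ d * ∫ x in (0 : ℝ)..1, H x ≤ ∑ i ∈ Finset.range (2 ^ d), H (i / 2 ^ d) := by
  have := Monotone.sum_dyadic_le_integral (H := fun x => - H x) (fun x y hxy => neg_le_neg (hH hxy)) d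
  simp only [Finset.sum_neg_distrib, intervalIntegral.integral_neg, mul_neg, neg_le_neg_iff] at this
  exact this.symm

/-- Telescoping: the gap between upper and lower sums is the variation of H, independently of the
number of columns. -/
lemma sum_dyadic_sub (H : ℝ → ℝ) (d : ℕ) :
    ∑ i ∈ Finset.range (2 ^ d), H ((i + 1) / 2 ^ d) - ∑ i ∈ Finset.range (2 ^ d), H (i / 2 ^ d) =
      H 1 - H 0 := by
  rw [← Finset.sum_sub_distrib]
  have := Finset.sum_range_sub (fun i : ℕ => H (i / 2 ^ d)) (2 ^ d)
  push_cast at this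
  rwa [div_self (by positivity), zero_div] at this

open Finset in
/-- Discrepancy of a net with respect to the region below a monotone graph. -/
lemma IsTMSNet.abs_card_below_sub_le {m d e : ℕ} {u : Fin (2 ^ m) → Fin 2 → ℝ}
    (hu : IsTMSNet 0 m 2 2 u) (h01 : ∀ n j, u n j ∈ Set.Ico (0 : ℝ) 1)
    (hde : d + e = m) {H : ℝ → ℝ} (hH : Monotone H ∨ Antitone H)
    (hH01 : ∀ x, H x ∈ Set.Icc (0 : ℝ) 1) :
    |(#{n | u n 1 ≤ H (u n 0)} : ℝ) - 2 ^ m * ∫ x in (0 : ℝ)..1, H x| ≤ 2 ^ d + 2 ^ e := by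
  have hd : (0 : ℝ) < 2 ^ d := by positivity
  have he : (0 : ℝ) < 2 ^ e := by positivity
  have hm : (2 : ℝ) ^ m = 2 ^ e * 2 ^ d := by rw [← hde, pow_add, mul_comm]
  have hs := sum_dyadic_sub H d
  have h0 := hH01 0
  have h1 := hH01 1
  have hstep : ∀ i : ℕ, (i : ℝ) / 2 ^ d ≤ ((i : ℝ) + 1) / 2 ^ d := fun i => by gcongr; linarith
  rw [abs_le, hm, mul_assoc]
  rcases hH with hH | hH
  · obtain ⟨ha, hb⟩ := hH.sum_dyadic_le_integral d
    obtain ⟨hc, hf⟩ := hu.card_below h01 hde H (fun i => H (i / 2 ^ d))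
      (fun i => H ((i + 1) / 2 ^ d)) (fun i => (hH01 _).1) (fun i => (hH01 _).2)
      (fun i => hH (hstep i)) (fun n i _ hn => ⟨hH hn.1, hH hn.2.le⟩)
    have ha' := mul_le_mul_of_nonneg_left ha he.le
    have hb' := mul_le_mul_of_nonneg_left hb he.le
    -- The two error terms: 2^e from the variation of H, at most 1, and 2^d from one point of
    -- rounding per column.
    have hs' : 2 ^ e * ∑ i ∈ Finset.range (2 ^ d), H ((i + 1) / 2 ^ d) ≤
        2 ^ e * ∑ i ∈ Finset.range (2 ^ d), H (i / 2 ^ d) + 2 ^ e := by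
      nlinarith [h0.1, h1.2]
    constructor <;> linarith
  · obtain ⟨ha, hb⟩ := hH.sum_dyadic_le_integral d
    obtain ⟨hc, hf⟩ := hu.card_below h01 hde H (fun i => H ((i + 1) / 2 ^ d))
      (fun i => H (i / 2 ^ d)) (fun i => (hH01 _).1) (fun i => (hH01 _).2)
      (fun i => hH (hstep i)) (fun n i _ hn => ⟨hH hn.2.le, hH hn.1⟩)
    have ha' := mul_le_mul_of_nonneg_left ha he.le
    have hb' := mul_le_mul_of_nonneg_left hb he.le
    have hs' : 2 ^ e * ∑ i ∈ Finset.range (2 ^ d), H (i / 2 ^ d) ≤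
        2 ^ e * ∑ i ∈ Finset.range (2 ^ d), H ((i + 1) / 2 ^ d) + 2 ^ e := by
      nlinarith [h0.2, h1.1]
    constructor <;> linarith

/-- Balances the two errors by taking d and e equal up to one; the odd case 2^q + 2^(q+1) = 3 · 2^q
dictates the 3. -/
lemma exists_two_pow_add_two_pow_le (m : ℕ) :
    ∃ d e : ℕ, d + e = m ∧ (2 : ℝ) ^ d + 2 ^ e ≤ 3 * √2 ^ m := by
  have h2 : (√2 : ℝ) ^ 2 = 2 := Real.sq_sqrt (by norm_num)
  have h1 : (1 : ℝ) ≤ √2 := by rw [Real.one_le_sqrt]; norm_num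
  obtain ⟨q, rfl | rfl⟩ := Nat.even_or_odd' m
  · refine ⟨q, q, by omega, ?_⟩
    rw [pow_mul, h2]
    have : (0 : ℝ) < 2 ^ q := by positivity
    linarith
  · refine ⟨q, q + 1, by omega, ?_⟩
    rw [pow_succ, pow_succ, pow_mul, h2]
    have : (0 : ℝ) < 2 ^ q := by positivity
    nlinarith

lemma IsTSSequence.abs_countBelow_block_sub_le {u : ℕ → Fin 2 → ℝ} (hu : IsTSSequence 0 2 2 u)
    {H : ℝ → ℝ} (hH : Monotone H ∨ Antitone H) (hH01 : ∀ x, H x ∈ Set.Icc (0 : ℝ) 1) (k m : ℕ) :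
    |(countBelow u H (k * 2 ^ m) (2 ^ m) : ℝ) - (2 ^ m : ℕ) * ∫ x in (0 : ℝ)..1, H x| ≤
      3 * √2 ^ m := by
  obtain ⟨d, e, hde, hle⟩ := exists_two_pow_add_two_pow_le m
  refine le_trans ?_ hle
  have := (hu.2 k m (Nat.zero_le _)).abs_card_below_sub_le (fun n j => hu.1 _ j) hde hH hH01
  rw [Finset.card_filter, ← Finset.sum_range (fun n => if u (k * 2 ^ m + n) 1 ≤
    H (u (k * 2 ^ m + n) 0) then 1 else 0), ← Finset.card_filter] at this
  rw [countBelow]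
  push_cast
  exact this

/-- Binary splitting: if r ≥ 2^j, remove a full block of length 2^j; the rest again starts at a
multiple of 2^j. The constant 8 closes the induction because 3 + 8 ≤ 8√2. -/
lemma IsTSSequence.abs_countBelow_aligned_sub_le {u : ℕ → Fin 2 → ℝ} (hu : IsTSSequence 0 2 2 u)
    {H : ℝ → ℝ} (hH : Monotone H ∨ Antitone H) (hH01 : ∀ x, H x ∈ Set.Icc (0 : ℝ) 1) (j : ℕ) :
    ∀ k r : ℕ, r < 2 ^ j →
    |(countBelow u H (k * 2 ^ j) r : ℝ) - r * ∫ x in (0 : ℝ)..1, H x| ≤ 8 * √2 ^ j := by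
  have hs : (1.4 : ℝ) ≤ √2 := by
    apply Real.le_sqrt_of_sq_le
    norm_num
  induction j with
  | zero =>
    intro k r hr
    obtain rfl : r = 0 := by simpa using hr
    simp [countBelow]
  | succ j ih =>
    intro k r hr
    have hb : (0 : ℝ) < √2 ^ j := by positivity
    have e1 : k * 2 ^ (j + 1) = (2 * k) * 2 ^ j := by ring
    rw [pow_succ (√2), e1]
    rcases lt_or_ge r (2 ^ j) with h | h
    · refine (ih (2 * k) r h).trans ?_
      nlinarith
    · obtain ⟨r', rfl⟩ := Nat.exists_eq_add_of_le h
      have h1 := ih (2 * k + 1) r' (by rw [pow_succ] at hr; omega)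
      have h2 := hu.abs_countBelow_block_sub_le hH hH01 (2 * k) j
      rw [countBelow_add, show 2 * k * 2 ^ j + 2 ^ j = (2 * k + 1) * 2 ^ j by ring]
      rw [abs_le] at h1 h2 ⊢
      have h3 : 11 * √2 ^ j ≤ 8 * (√2 ^ j * √2) := by nlinarith
      rw [Nat.cast_add, Nat.cast_add, add_mul ((2 ^ j : ℕ) : ℝ)]
      constructor <;> linarith

/-- The first `N` points of a `(0, 2)`-sequence have discrepancy of order `N ^ (-1/2)` with respect
to the regions below monotone graphs. -/
lemma IsTSSequence.abs_countBelow_sub_le {u : ℕ → Fin 2 → ℝ} (hu : IsTSSequence 0 2 2 u)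
    {H : ℝ → ℝ} (hH : Monotone H ∨ Antitone H) (hH01 : ∀ x, H x ∈ Set.Icc (0 : ℝ) 1) (N : ℕ) :
    |(countBelow u H 0 N : ℝ) - N * ∫ x in (0 : ℝ)..1, H x| ≤ 12 * √N := by
  rcases Nat.eq_zero_or_pos N with rfl | hN
  · simp [countBelow]
  -- Here 2^j > N with j = log₂ N + 1, and 8 √2^j ≤ 8√2 · √N ≤ 12 √N.
  have h := hu.abs_countBelow_aligned_sub_le hH hH01 (Nat.log 2 N + 1) 0 N
    (Nat.lt_pow_succ_log_self (by norm_num) N)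
  rw [zero_mul] at h
  refine h.trans ?_
  have h1 : (√2 : ℝ) ^ (Nat.log 2 N) ≤ √N := by
    apply Real.le_sqrt_of_sq_le
    rw [← pow_mul, mul_comm, pow_mul, Real.sq_sqrt (by norm_num)]
    exact_mod_cast Nat.pow_log_le_self 2 hN.ne'
  have h2 : √2 ≤ 1.5 := by
    rw [Real.sqrt_le_left (by norm_num)]
    norm_num
  rw [pow_succ]
  have := mul_le_mul h1 h2 (by positivity) (by positivity)
  linarith

/-! ### Quantile transform -/

section Quantile

variable {μ : Measure ℝ}

lemma bddBelow_le_cdf {p : ℝ} (hp : 0 < p) : BddBelow {x | p ≤ cdf μ x} := by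
  obtain ⟨b, hb⟩ := ((tendsto_cdf_atBot μ).eventually_lt_const hp).exists
  refine ⟨b, fun x hx => ?_⟩
  by_contra! h
  exact absurd (hx.trans (monotone_cdf μ h.le)) (not_le.2 hb)

lemma le_cdf_nonempty {p : ℝ} (hp : p < 1) : {x | p ≤ cdf μ x}.Nonempty := by
  obtain ⟨b, hb⟩ := ((tendsto_cdf_atTop μ).eventually_const_lt hp).exists
  exact ⟨b, hb.le⟩

/-- Right-continuity of the cdf makes the infimum attained. This Galois connection turns events on
particles into events on the driving points. -/
lemma quantile_le_iff {p : ℝ} (hp : p ∈ Set.Ioo (0 : ℝ) 1) (a : ℝ) :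
    quantile μ p ≤ a ↔ p ≤ cdf μ a := by
  constructor
  · intro h
    refine le_trans ?_ (monotone_cdf μ h)
    have hc : Filter.Tendsto (cdf μ) (nhdsWithin (quantile μ p) (Set.Ioi (quantile μ p)))
        (nhds (cdf μ (quantile μ p))) :=
      ((cdf μ).right_continuous _).mono_left (nhdsWithin_mono _ Set.Ioi_subset_Ici_self)
    refine ge_of_tendsto hc ?_
    filter_upwards [self_mem_nhdsWithin] with x hx
    obtain ⟨y, hy, hyx⟩ := exists_lt_of_csInf_lt (le_cdf_nonempty hp.2) hx
    exact hy.trans (monotone_cdf μ hyx.le)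
  · exact fun h => csInf_le (bddBelow_le_cdf hp.1) h

lemma monotoneOn_quantile : MonotoneOn (quantile μ) (Set.Ioo 0 1) := by
  intro p hp q hq hpq
  rw [quantile_le_iff hp]
  exact hpq.trans ((quantile_le_iff hq _).1 le_rfl)

lemma aemeasurable_quantile : AEMeasurable (quantile μ) (volume.restrict (Set.Ioo 0 1)) :=
  aemeasurable_restrict_of_monotoneOn measurableSet_Ioo monotoneOn_quantile

instance isProbabilityMeasure_uniform :
    IsProbabilityMeasure ((volume : Measure ℝ).restrict (Set.Ioo 0 1)) := ⟨by simp⟩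

lemma map_quantile [IsProbabilityMeasure μ] :
    (volume.restrict (Set.Ioo 0 1)).map (quantile μ) = μ := by
  have := Measure.isProbabilityMeasure_map (aemeasurable_quantile (μ := μ))
  refine Measure.ext_of_Iic _ _ fun a => ?_
  rw [Measure.map_apply_of_aemeasurable aemeasurable_quantile measurableSet_Iic, ← ofReal_cdf μ]
  have hae : (quantile μ ⁻¹' Set.Iic a : Set ℝ) =ᵐ[volume.restrict (Set.Ioo 0 1)]
      Set.Iic (cdf μ a) := by
    filter_upwards [ae_restrict_mem measurableSet_Ioo] with p hp
    exact propext (quantile_le_iff hp a)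
  rw [measure_congr hae, Measure.restrict_apply measurableSet_Iic]
  rcases (cdf_le_one μ a).lt_or_eq with h | h
  · have : Set.Iic (cdf μ a) ∩ Set.Ioo 0 1 = Set.Ioc 0 (cdf μ a) := by
      ext x
      simp only [Set.mem_inter_iff, Set.mem_Iic, Set.mem_Ioo, Set.mem_Ioc]
      constructor
      · rintro ⟨h1, h2, h3⟩; exact ⟨h2, h1⟩
      · rintro ⟨h1, h2⟩; exact ⟨h2, h1, h2.trans_lt h⟩
    rw [this, Real.volume_Ioc, sub_zero]
  · have : Set.Iic (cdf μ a) ∩ Set.Ioo 0 1 = Set.Ioo 0 1 := by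
      rw [h]
      exact Set.inter_eq_self_of_subset_right fun x hx => hx.2.le
    rw [this, Real.volume_Ioo, h, sub_zero]

end Quantile

/-- `quantile` is known to be monotone only on (0,1), while the discrepancy bounds are stated for
globally monotone graphs; clamping keeps the values in [0,1]. -/
lemma exists_monotone_or_antitone_extension {f : ℝ → ℝ} {s : Set ℝ}
    (hf : MonotoneOn f s ∨ AntitoneOn f s) (h01 : ∀ x, f x ∈ Set.Icc (0 : ℝ) 1) :
    ∃ H : ℝ → ℝ, (Monotone H ∨ Antitone H) ∧ (∀ x, H x ∈ Set.Icc (0 : ℝ) 1) ∧ Set.EqOn f H s := by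
  have hb : BddBelow (f '' s) := ⟨0, by rintro _ ⟨x, -, rfl⟩; exact (h01 x).1⟩
  have hB : BddAbove (f '' s) := ⟨1, by rintro _ ⟨x, -, rfl⟩; exact (h01 x).2⟩
  have key : ∀ g : ℝ → ℝ, Set.EqOn f g s → Set.EqOn f (fun x => max 0 (min 1 (g x))) s := by
    intro g hg x hx
    simp only
    rw [← hg hx, min_eq_right (h01 x).2, max_eq_right (h01 x).1]
  have hm : Monotone fun y : ℝ => max 0 (min 1 y) := fun a b hab =>
    max_le_max le_rfl (min_le_min le_rfl hab)
  have hr : ∀ y : ℝ, max 0 (min 1 y) ∈ Set.Icc (0 : ℝ) 1 := fun y => by simp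
  rcases hf with hf | hf
  · obtain ⟨g, hg, he⟩ := hf.exists_monotone_extension hb hB
    exact ⟨_, Or.inl (hm.comp hg), fun x => hr _, key g he⟩
  · obtain ⟨g, hg, he⟩ := hf.exists_antitone_extension hb hB
    exact ⟨_, Or.inr (hm.comp_antitone hg), fun x => hr _, key g he⟩

/-! ### Empirical measures and Kolmogorov distance -/

lemma isProbabilityMeasure_empirical {N : ℕ} (hN : 1 ≤ N) (x : Fin N → ℝ) :
    IsProbabilityMeasure (empirical x) := by
  constructor
  have hN0 : (0 : ℝ) < N := by exact_mod_cast hN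
  simp only [empirical, Measure.coe_finsetSum, Finset.sum_apply, Measure.smul_apply,
    measure_univ, smul_eq_mul, mul_one, Finset.sum_const, Finset.card_univ, Fintype.card_fin,
    nsmul_eq_mul]
  rw [← ENNReal.ofReal_natCast, ← ENNReal.ofReal_mul (by positivity)]
  simp [hN0.ne']

open Finset in
lemma cdf_empirical {N : ℕ} (hN : 1 ≤ N) (x : Fin N → ℝ) (a : ℝ) :
    cdf (empirical x) a = (#{n | x n ≤ a} : ℝ) / N := by
  have := isProbabilityMeasure_empirical hN x
  rw [cdf_eq_real, measureReal_def, empirical]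
  simp only [Measure.coe_finsetSum, Finset.sum_apply, Measure.smul_apply,
    Measure.dirac_apply' _ measurableSet_Iic, smul_eq_mul]
  rw [ENNReal.toReal_sum]
  · simp only [Set.indicator, Set.mem_Iic, ENNReal.toReal_mul, Pi.one_apply]
    rw [card_filter, Nat.cast_sum, sum_div]
    refine sum_congr rfl fun n _ => ?_
    rw [ENNReal.toReal_ofReal (by positivity)]
    split_ifs <;> simp
  · intro n _
    simp only [Set.indicator]
    split_ifs <;> simp

lemma bddAbove_range_cdf_sub (μ ν : Measure ℝ) :
    BddAbove (Set.range fun a : ℝ => |cdf μ a - cdf ν a|) := by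
  refine ⟨1, ?_⟩
  rintro _ ⟨a, rfl⟩
  rw [abs_le]
  constructor <;> linarith [cdf_nonneg μ a, cdf_nonneg ν a, cdf_le_one μ a, cdf_le_one ν a]

lemma abs_cdf_sub_le_kolmogorovDist (μ ν : Measure ℝ) (a : ℝ) :
    |cdf μ a - cdf ν a| ≤ kolmogorovDist μ ν :=
  le_ciSup (bddAbove_range_cdf_sub μ ν) a

lemma kolmogorovDist_le {μ ν : Measure ℝ} {r : ℝ} (h : ∀ a, |cdf μ a - cdf ν a| ≤ r) :
    kolmogorovDist μ ν ≤ r := ciSup_le h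

lemma kolmogorovDist_nonneg (μ ν : Measure ℝ) : 0 ≤ kolmogorovDist μ ν :=
  (abs_nonneg _).trans (abs_cdf_sub_le_kolmogorovDist μ ν 0)

lemma kolmogorovDist_triangle (μ ν π : Measure ℝ) :
    kolmogorovDist μ π ≤ kolmogorovDist μ ν + kolmogorovDist ν π :=
  kolmogorovDist_le fun a => (abs_sub_le _ (cdf ν a) _).trans
    (add_le_add (abs_cdf_sub_le_kolmogorovDist _ _ a) (abs_cdf_sub_le_kolmogorovDist _ _ a))

lemma cdf_bind (μ : Measure ℝ) [IsProbabilityMeasure μ] (K : Kernel ℝ ℝ) [IsMarkovKernel K]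
    (a : ℝ) : cdf (μ.bind K) a = ∫ z, cdf (K z) a ∂μ := by
  rw [cdf_eq_real, measureReal_def, Measure.bind_apply measurableSet_Iic K.aemeasurable,
    ← integral_toReal (K.measurable_coe measurableSet_Iic).aemeasurable (by simp)]
  simp only [cdf_eq_real, measureReal_def]

/-- Discrepancy estimate for point sets obtained by transforming a `(0, 2)`-sequence. -/
lemma abs_cdf_empirical_sub_le {u : ℕ → Fin 2 → ℝ} (hu : IsTSSequence 0 2 2 u) {N : ℕ}
    (hN : 1 ≤ N) {H : ℝ → ℝ} (hH : Monotone H ∨ Antitone H) (hH01 : ∀ x, H x ∈ Set.Icc (0 : ℝ) 1)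
    (x : Fin N → ℝ) (a : ℝ) (hx : ∀ n : Fin N, x n ≤ a ↔ u n 1 ≤ H (u n 0)) :
    |cdf (empirical x) a - ∫ y in Set.Ioo (0 : ℝ) 1, H y| ≤ 12 / √N := by
  have hN0 : (0 : ℝ) < N := by exact_mod_cast hN
  have h := hu.abs_countBelow_sub_le hH hH01 N
  rw [countBelow, Finset.card_filter, Finset.sum_range, ← Finset.card_filter] at h
  simp only [zero_add, ← hx] at h
  rw [cdf_empirical hN, ← integral_Ioc_eq_integral_Ioo,
    ← intervalIntegral.integral_of_le zero_le_one]
  have e : ∀ C I : ℝ, C / N - I = (C - N * I) / N := fun C I => by field_simp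
  rw [e, abs_div, abs_of_pos hN0, div_le_div_iff₀ hN0 (by positivity)]
  calc _ ≤ 12 * √N * √N := by gcongr
    _ = 12 * N := by rw [mul_assoc, Real.mul_self_sqrt hN0.le]

lemma cdf_gaussianReal_eq (m : ℝ) (v : NNReal) (a : ℝ) :
    cdf (gaussianReal m v) a = cdf (gaussianReal 0 v) (a - m) := by
  rw [cdf_eq_real, cdf_eq_real, measureReal_def, measureReal_def]
  have : gaussianReal m v = (gaussianReal 0 v).map (· + m) := by
    rw [gaussianReal_map_add_const, zero_add]
  rw [this, Measure.map_apply (by fun_prop) measurableSet_Iic]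
  congr 2
  ext x
  simp [le_sub_iff_add_le]

lemma cdf_transition (ρ σ z a : ℝ) : cdf (transition ρ σ z) a =
    cdf (gaussianReal 0 (σ ^ 2).toNNReal) (a - ρ * z) := cdf_gaussianReal_eq _ _ _

/-- The kernel is a location family with location ρ z, so the sign of ρ decides the direction. This
is what makes the regions of the resampling and mutation step monotone. -/
lemma monotone_or_antitone_cdf_transition (ρ σ a : ℝ) :
    (Monotone fun z => cdf (transition ρ σ z) a) ∨ Antitone fun z => cdf (transition ρ σ z) a := by
  simp only [cdf_transition]
  rcases le_total 0 ρ with h | h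
  · right
    intro x y hxy
    exact monotone_cdf _ (sub_le_sub_left (mul_le_mul_of_nonneg_left hxy h) _)
  · left
    intro x y hxy
    exact monotone_cdf _ (sub_le_sub_left (mul_le_mul_of_nonpos_left hxy h) _)

/-- Error of the inversion method for an initial distribution. -/
lemma kolmogorovDist_empirical_quantile_le {u : ℕ → Fin 2 → ℝ} (hu : IsTSSequence 0 2 2 u)
    (h01 : ∀ n j, u n j ∈ Set.Ioo (0 : ℝ) 1) {N : ℕ} (hN : 1 ≤ N) (μ : Measure ℝ)
    [IsProbabilityMeasure μ] :
    kolmogorovDist (empirical fun n : Fin N => quantile μ (u n 0)) μ ≤ 12 / √N := by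
  refine kolmogorovDist_le fun a => ?_
  -- Only the first coordinate matters here: as the second lies strictly between 0 and 1, being
  -- below the graph of this indicator means that the first is at most the cdf at `a`.
  have hanti : Antitone ((Set.Iic (cdf μ a)).indicator (1 : ℝ → ℝ)) := by
    intro x y hxy
    simp only [Set.indicator, Set.mem_Iic, Pi.one_apply]
    split_ifs with h1 h2 <;> first | exact absurd (hxy.trans h1) h2 | norm_num
  have key := abs_cdf_empirical_sub_le hu hN (Or.inr hanti) (fun x => by
    simp only [Set.indicator, Pi.one_apply]; split_ifs <;> simp)
    (fun n => quantile μ (u n 0)) a (fun n => by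
      rw [quantile_le_iff (h01 n 0)]
      simp only [Set.indicator, Set.mem_Iic, Pi.one_apply]
      split_ifs with h
      · exact iff_of_true h (h01 n 1).2.le
      · exact iff_of_false h (not_le.2 (h01 n 1).1))
  have hint : ∫ y in Set.Ioo (0 : ℝ) 1, (Set.Iic (cdf μ a)).indicator (1 : ℝ → ℝ) y = cdf μ a := by
    rw [integral_indicator_one measurableSet_Iic]
    conv_rhs => rw [cdf_eq_real, ← map_quantile (μ := μ)]
    rw [measureReal_def, measureReal_def,
      Measure.map_apply_of_aemeasurable aemeasurable_quantile measurableSet_Iic]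
    congr 1
    refine measure_congr ?_
    filter_upwards [ae_restrict_mem measurableSet_Ioo] with p hp
    exact propext (quantile_le_iff hp a).symm
  rwa [hint] at key

/-- Error of one step of the algorithm (resampling and mutation). -/
lemma kolmogorovDist_empirical_transition_le {u : ℕ → Fin 2 → ℝ} (hu : IsTSSequence 0 2 2 u)
    (h01 : ∀ n j, u n j ∈ Set.Ioo (0 : ℝ) 1) {N : ℕ} (hN : 1 ≤ N) (ρ σ : ℝ) (μ : Measure ℝ)
    [IsProbabilityMeasure μ] :
    kolmogorovDist
      (empirical fun n : Fin N => quantile (transition ρ σ (quantile μ (u n 0))) (u n 1))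
      (μ.bind (transition ρ σ)) ≤ 12 / √N := by
  refine kolmogorovDist_le fun a => ?_
  -- The particle is at most `a` iff the second coordinate is at most `f` of the first, by
  -- `quantile_le_iff`.
  set f : ℝ → ℝ := fun p => cdf (transition ρ σ (quantile μ p)) a with hf
  have hmono : MonotoneOn f (Set.Ioo 0 1) ∨ AntitoneOn f (Set.Ioo 0 1) := by
    rcases monotone_or_antitone_cdf_transition ρ σ a with h | h
    · exact Or.inl fun x hx y hy hxy => h (monotoneOn_quantile hx hy hxy)
    · exact Or.inr fun x hx y hy hxy => h (monotoneOn_quantile hx hy hxy)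
  obtain ⟨H, hH, hH01, heq⟩ := exists_monotone_or_antitone_extension hmono
    (fun x => ⟨cdf_nonneg _ _, cdf_le_one _ _⟩)
  have key := abs_cdf_empirical_sub_le hu hN hH hH01
    (fun n : Fin N => quantile (transition ρ σ (quantile μ (u n 0))) (u n 1)) a (fun n => by
      rw [quantile_le_iff (h01 n 1), ← heq (h01 n 0)])
  have hint : ∫ y in Set.Ioo (0 : ℝ) 1, H y = cdf (μ.bind (transition ρ σ)) a := by
    rw [cdf_bind, setIntegral_congr_fun measurableSet_Ioo heq.symm]
    conv_rhs => rw [← map_quantile (μ := μ)]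
    rw [integral_map aemeasurable_quantile]
    rcases monotone_or_antitone_cdf_transition ρ σ a with h | h
    · exact h.measurable.aestronglyMeasurable
    · exact h.measurable.aestronglyMeasurable
  rwa [hint] at key

/-! ### Gaussian computations -/

lemma likelihood_pos (p x : ℝ) : 0 < likelihood p x := Real.exp_pos _

lemma likelihood_le_one {p : ℝ} (hp : 0 ≤ p) (x : ℝ) : likelihood p x ≤ 1 := by
  rw [likelihood, Real.exp_le_one_iff]
  nlinarith [mul_nonneg hp (sq_nonneg x)]

lemma likelihood_anti {p q : ℝ} (hpq : p ≤ q) (x : ℝ) : likelihood q x ≤ likelihood p x := by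
  rw [likelihood, likelihood, Real.exp_le_exp]
  nlinarith [mul_le_mul_of_nonneg_right hpq (sq_nonneg x)]

lemma likelihood_mul (p q x : ℝ) : likelihood p x * likelihood q x = likelihood (p + q) x := by
  rw [likelihood, likelihood, likelihood, ← Real.exp_add]
  ring_nf

@[fun_prop]
lemma continuous_likelihood (p : ℝ) : Continuous (likelihood p) := by
  unfold likelihood
  fun_prop

@[fun_prop]
lemma measurable_likelihood (p : ℝ) : Measurable (likelihood p) :=
  (continuous_likelihood p).measurable

lemma integrable_likelihood {p : ℝ} (hp : 0 ≤ p) (μ : Measure ℝ) [IsFiniteMeasure μ] :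
    Integrable (likelihood p) μ :=
  .of_bound (continuous_likelihood p).aestronglyMeasurable 1 (.of_forall fun x => by
    rw [Real.norm_of_nonneg (likelihood_pos p x).le]
    exact likelihood_le_one hp x)

lemma integral_likelihood_pos {p : ℝ} (hp : 0 ≤ p) (μ : Measure ℝ) [IsProbabilityMeasure μ] :
    0 < ∫ x, likelihood p x ∂μ := by
  rw [integral_pos_iff_support_of_nonneg (fun x => (likelihood_pos p x).le)
    (integrable_likelihood hp μ)]
  have : Function.support (likelihood p) = Set.univ := by
    ext x; simp [(likelihood_pos p x).ne']
  simp [this]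

lemma integral_likelihood_le_one {p : ℝ} (hp : 0 ≤ p) (μ : Measure ℝ) [IsProbabilityMeasure μ] :
    ∫ x, likelihood p x ∂μ ≤ 1 := by
  have := integral_mono (integrable_likelihood hp μ) (integrable_const (1 : ℝ))
    (likelihood_le_one hp)
  simpa using this

lemma lintegral_likelihood {p : ℝ} (hp : 0 ≤ p) (μ : Measure ℝ) [IsFiniteMeasure μ] :
    ∫⁻ x, ENNReal.ofReal (likelihood p x) ∂μ = ENNReal.ofReal (∫ x, likelihood p x ∂μ) :=
  (ofReal_integral_eq_lintegral_ofReal (integrable_likelihood hp μ)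
    (.of_forall fun x => (likelihood_pos p x).le)).symm

/-- Completing the square. -/
lemma gaussianPDFReal_mul_likelihood (m p x : ℝ) (v : NNReal) (hv : v ≠ 0) (hp : 0 ≤ p) :
    gaussianPDFReal m v x * likelihood p x =
      (√(1 + p * v))⁻¹ * likelihood (p / (1 + p * v)) m *
        gaussianPDFReal (m / (1 + p * v)) (v / (1 + p * v).toNNReal) x := by
  have hv0 : (0 : ℝ) < v := by positivity
  have h1 : (0 : ℝ) < 1 + p * v := by positivity
  have h2 : (√(1 + p * v)) ≠ 0 := by positivity
  simp only [gaussianPDFReal, likelihood, NNReal.coe_div, Real.coe_toNNReal _ h1.le]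
  rw [← mul_div_assoc (2 * Real.pi), Real.sqrt_div (by positivity), inv_div]
  have h3 : √(2 * Real.pi * v) ≠ 0 := by positivity
  have hexp : Real.exp (-(x - m) ^ 2 / (2 * v)) * Real.exp (-p * x ^ 2 / 2) =
      Real.exp (-(p / (1 + p * v)) * m ^ 2 / 2) *
        Real.exp (-(x - m / (1 + p * v)) ^ 2 / (2 * (v / (1 + p * v)))) := by
    rw [← Real.exp_add, ← Real.exp_add]
    congr 1
    field_simp
    ring
  rw [mul_assoc, hexp]
  field_simp

/-- A Gaussian measure reweighted by a centered Gaussian function. -/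
lemma lintegral_likelihood_mul_gaussianReal (m : ℝ) (v : NNReal) {p : ℝ} (hp : 0 ≤ p)
    {ψ : ℝ → ℝ≥0∞} (hψ : Measurable ψ) :
    ∫⁻ x, ENNReal.ofReal (likelihood p x) * ψ x ∂gaussianReal m v =
      ENNReal.ofReal ((√(1 + p * v))⁻¹ * likelihood (p / (1 + p * v)) m) *
        ∫⁻ x, ψ x ∂gaussianReal (m / (1 + p * v)) (v / (1 + p * v).toNNReal) := by
  have hl : Measurable fun x => ENNReal.ofReal (likelihood p x) :=
    (measurable_likelihood p).ennreal_ofReal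
  have hlψ : Measurable fun x => ENNReal.ofReal (likelihood p x) * ψ x := hl.mul hψ
  -- The Dirac case is needed because `spread` vanishes at index 0.
  by_cases hv : v = 0
  · subst hv
    simp only [gaussianReal_zero_var, NNReal.coe_zero, mul_zero, add_zero, div_one, zero_div]
    rw [lintegral_dirac' _ hlψ, lintegral_dirac' _ hψ]
    simp
  · have h1 : (0 : ℝ) < 1 + p * v := by positivity
    have hv' : v / (1 + p * v).toNNReal ≠ 0 := div_ne_zero hv (by simpa using h1)
    rw [gaussianReal_of_var_ne_zero _ hv, gaussianReal_of_var_ne_zero _ hv',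
      lintegral_withDensity_eq_lintegral_mul _ (measurable_gaussianPDF _ _) hlψ,
      lintegral_withDensity_eq_lintegral_mul _ (measurable_gaussianPDF _ _) hψ,
      ← lintegral_const_mul _ ((measurable_gaussianPDF _ _).mul hψ)]
    refine lintegral_congr fun x => ?_
    simp only [Pi.mul_apply, gaussianPDF]
    rw [← mul_assoc, ← mul_assoc, ← ENNReal.ofReal_mul (gaussianPDFReal_nonneg _ _ _),
      gaussianPDFReal_mul_likelihood m p x v hv hp, ENNReal.ofReal_mul]
    exact mul_nonneg (by positivity) (likelihood_pos _ _).le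

lemma lintegral_likelihood_gaussianReal (m : ℝ) (v : NNReal) {p : ℝ} (hp : 0 ≤ p) :
    ∫⁻ x, ENNReal.ofReal (likelihood p x) ∂gaussianReal m v =
      ENNReal.ofReal ((√(1 + p * v))⁻¹ * likelihood (p / (1 + p * v)) m) := by
  simpa using lintegral_likelihood_mul_gaussianReal m v hp (ψ := fun _ => 1) measurable_const

lemma lintegral_gaussianReal_gaussianReal (a m : ℝ) (s v : NNReal) {φ : ℝ → ℝ≥0∞}
    (hφ : Measurable φ) :
    ∫⁻ x, ∫⁻ y, φ y ∂gaussianReal (m * x) v ∂gaussianReal a s =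
      ∫⁻ y, φ y ∂gaussianReal (m * a) (v + (m ^ 2).toNNReal * s) := by
  have h1 : gaussianReal (m * a) (v + (m ^ 2).toNNReal * s) =
      (gaussianReal a s).map (m * ·) ∗ gaussianReal 0 v := by
    rw [gaussianReal_map_const_mul, gaussianReal_conv_gaussianReal, add_zero, add_comm]
    congr 3
    ext
    simp [sq_nonneg]
  have h2 : ∀ x, gaussianReal (m * x) v = (gaussianReal 0 v).map (m * x + ·) := by
    intro x
    rw [gaussianReal_map_const_add, zero_add]
  rw [h1, Measure.lintegral_conv hφ, lintegral_map (by fun_prop) (by fun_prop)]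
  refine lintegral_congr fun x => ?_
  rw [h2, lintegral_map hφ (by fun_prop)]

/-! ### Gaussian parameters of the iterated kernels -/

/-- Precision of the Gaussian function `z ↦ G(z) Q^k(z, ℝ)`. -/
def precision (ρ s c : ℝ) : ℕ → ℝ
  | 0 => c
  | k + 1 => c + ρ ^ 2 * precision ρ s c k / (1 + precision ρ s c k * s)

/-- Slope of the mean of the Gaussian distribution `Q^k(z, ·) / Q^k(z, ℝ)` as a function of `z`. -/
def slope (ρ s c : ℝ) : ℕ → ℝ
  | 0 => 1
  | k + 1 => slope ρ s c k * (ρ / (1 + precision ρ s c k * s))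

/-- Variance of the Gaussian distribution `Q^k(z, ·) / Q^k(z, ℝ)`. -/
def spread (ρ s c : ℝ) : ℕ → ℝ
  | 0 => 0
  | k + 1 => spread ρ s c k + slope ρ s c k ^ 2 * (s / (1 + precision ρ s c k * s))

section Parameters

variable {ρ s c : ℝ}

lemma le_precision (hs : 0 < s) (hc : 0 < c) (k : ℕ) : c ≤ precision ρ s c k := by
  induction k with
  | zero => exact le_rfl
  | succ k ih =>
    have : 0 < precision ρ s c k := hc.trans_le ih
    rw [precision]
    have : 0 ≤ ρ ^ 2 * precision ρ s c k / (1 + precision ρ s c k * s) := by positivity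
    linarith

lemma precision_pos (hs : 0 < s) (hc : 0 < c) (k : ℕ) : 0 < precision ρ s c k :=
  hc.trans_le (le_precision hs hc k)

lemma precision_le (hs : 0 < s) (hc : 0 < c) (k : ℕ) : precision ρ s c k ≤ c + ρ ^ 2 / s := by
  cases k with
  | zero =>
    have : 0 ≤ ρ ^ 2 / s := by positivity
    rw [precision]
    linarith
  | succ k =>
    have hp := precision_pos (ρ := ρ) hs hc k
    rw [precision]
    gcongr c + ?_
    rw [div_le_div_iff₀ (by positivity) hs]
    nlinarith [sq_nonneg ρ]

/-- The ratio slope²/precision shrinks by at least 1/(1 + c s) per step. Comparing with the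
precision, which is bounded, gives geometric decay even when |ρ| ≥ 1. -/
lemma slope_sq_le (hs : 0 < s) (hc : 0 < c) (k : ℕ) :
    slope ρ s c k ^ 2 * c ≤ precision ρ s c k * ((1 + c * s)⁻¹) ^ k := by
  induction k with
  | zero => simp [slope, precision]
  | succ k ih =>
    have hp := precision_pos (ρ := ρ) hs hc k
    have hcp := le_precision (ρ := ρ) hs hc k
    have hr : (0 : ℝ) ≤ ((1 + c * s)⁻¹) ^ k := by positivity
    set p := precision ρ s c k with hpdef
    have h1 : (ρ / (1 + p * s)) ^ 2 * p ≤ precision ρ s c (k + 1) * (1 + c * s)⁻¹ := by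
      rw [precision, ← hpdef]
      have e : (ρ / (1 + p * s)) ^ 2 * p = ρ ^ 2 * p / (1 + p * s) * (1 + p * s)⁻¹ := by
        field_simp
      rw [e]
      have h3 : 0 ≤ ρ ^ 2 * p / (1 + p * s) := by positivity
      have h4 : (1 + p * s)⁻¹ ≤ (1 + c * s)⁻¹ := by gcongr
      exact mul_le_mul (by linarith) h4 (by positivity) (by positivity)
    calc slope ρ s c (k + 1) ^ 2 * c
        = (ρ / (1 + p * s)) ^ 2 * (slope ρ s c k ^ 2 * c) := by rw [slope]; ring
      _ ≤ (ρ / (1 + p * s)) ^ 2 * (p * ((1 + c * s)⁻¹) ^ k) := by gcongr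
      _ = (ρ / (1 + p * s)) ^ 2 * p * ((1 + c * s)⁻¹) ^ k := by ring
      _ ≤ precision ρ s c (k + 1) * (1 + c * s)⁻¹ * ((1 + c * s)⁻¹) ^ k := by gcongr
      _ = _ := by ring

lemma spread_nonneg (hs : 0 < s) (hc : 0 < c) (k : ℕ) : 0 ≤ spread ρ s c k := by
  induction k with
  | zero => exact le_rfl
  | succ k ih =>
    have hp := precision_pos (ρ := ρ) hs hc k
    rw [spread]
    positivity

/-- The spread only grows with k, and its first increment is s/(1 + c s). This bounds the Gaussian
densities uniformly in k ≥ 1. -/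
lemma le_spread_succ (hs : 0 < s) (hc : 0 < c) (k : ℕ) :
    s / (1 + c * s) ≤ spread ρ s c (k + 1) := by
  induction k with
  | zero => simp [spread, slope, precision]
  | succ k ih =>
    have hp := precision_pos (ρ := ρ) hs hc (k + 1)
    rw [spread]
    exact ih.trans (le_add_of_nonneg_right (by positivity))

/-- The left side is nonincreasing in k and equals 1/c at 0. It is the variance of the final state
when a flat initial law is weighted by the Gaussian function of precision p_k. -/
lemma spread_add_le (hs : 0 < s) (hc : 0 < c) (k : ℕ) :
    spread ρ s c k + slope ρ s c k ^ 2 / precision ρ s c k ≤ c⁻¹ := by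
  induction k with
  | zero => simp [spread, slope, precision]
  | succ k ih =>
    refine le_trans ?_ ih
    have hp := precision_pos (ρ := ρ) hs hc k
    have hp' := precision_pos (ρ := ρ) hs hc (k + 1)
    rw [spread, slope, add_assoc]
    gcongr spread ρ s c k + ?_
    set p := precision ρ s c k with hpdef
    set p' := precision ρ s c (k + 1) with hpdef'
    have hle : ρ ^ 2 * p / (1 + p * s) ≤ p' := by
      rw [hpdef', precision]
      linarith
    have e1 : slope ρ s c k ^ 2 * (s / (1 + p * s)) +
        (slope ρ s c k * (ρ / (1 + p * s))) ^ 2 / p' =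
        slope ρ s c k ^ 2 * (s / (1 + p * s) + ρ ^ 2 * p / (1 + p * s) / p' / (p * (1 + p * s))) := by
      field_simp
    have h2 : ρ ^ 2 * p / (1 + p * s) / p' ≤ 1 := (div_le_one hp').2 hle
    have e2 : s / (1 + p * s) + 1 / (p * (1 + p * s)) = 1 / p := by field_simp; ring
    rw [e1, div_eq_mul_one_div _ p, ← e2]
    gcongr

lemma spread_le (hs : 0 < s) (hc : 0 < c) (k : ℕ) : spread ρ s c k ≤ c⁻¹ := by
  have hp := precision_pos (ρ := ρ) hs hc k
  exact (le_add_of_nonneg_right (by positivity)).trans (spread_add_le hs hc k)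

lemma slope_sq_le_div (hs : 0 < s) (hc : 0 < c) (k : ℕ) :
    slope ρ s c k ^ 2 ≤ precision ρ s c k / c := by
  have hp := precision_pos (ρ := ρ) hs hc k
  have h1 := spread_add_le (ρ := ρ) hs hc k
  have h2 := spread_nonneg (ρ := ρ) hs hc k
  have h3 : slope ρ s c k ^ 2 / precision ρ s c k ≤ c⁻¹ := by linarith
  rw [div_le_iff₀ hp] at h3
  rwa [div_eq_inv_mul]

end Parameters

/-! ### The filtering semigroup -/

/-- Induction peeling off the first transition: its weight G joins the remaining kernel to form the
induction hypothesis, then one completes the square and composes two Gaussian kernels. `A` does not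
depend on `z`, so it cancels on normalization. -/
lemma likelihood_mul_lintegral_unnormKernel_pow {ρ σ c : ℝ} (hσ : 0 < σ) (hc : 0 < c) (k : ℕ) :
    ∃ A : ℝ, 0 < A ∧ ∀ (z : ℝ) (φ : ℝ → ℝ≥0∞), Measurable φ →
      ENNReal.ofReal (likelihood c z) * ∫⁻ x, φ x ∂(unnormKernel ρ σ c ^ k : Kernel ℝ ℝ) z =
        ENNReal.ofReal (A * likelihood (precision ρ (σ ^ 2) c k) z) *
          ∫⁻ x, φ x ∂gaussianReal (slope ρ (σ ^ 2) c k * z) (spread ρ (σ ^ 2) c k).toNNReal := by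
  have hs : 0 < σ ^ 2 := by positivity
  induction k with
  | zero =>
    refine ⟨1, one_pos, fun z φ hφ => ?_⟩
    rw [pow_zero]
    change _ * ∫⁻ x, φ x ∂(Kernel.id z) = _
    simp [slope, spread, precision, Kernel.id_apply, gaussianReal_zero_var]
  | succ k ih =>
    obtain ⟨A, hA, ih⟩ := ih
    set p := precision ρ (σ ^ 2) c k with hp
    have hp0 : 0 < p := precision_pos hs hc k
    have h1 : 0 < 1 + p * σ ^ 2 := by positivity
    refine ⟨A * (√(1 + p * σ ^ 2))⁻¹, by positivity, fun z φ hφ => ?_⟩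
    have hG : Measurable fun x => ENNReal.ofReal (likelihood c x) :=
      (measurable_likelihood c).ennreal_ofReal
    have hGu : Measurable (Function.uncurry fun (_ : ℝ) x => ENNReal.ofReal (likelihood c x)) :=
      hG.comp measurable_snd
    have hQφ : Measurable fun y => ∫⁻ x, φ x ∂(unnormKernel ρ σ c ^ k : Kernel ℝ ℝ) y :=
      hφ.lintegral_kernel
    have hQ : ∀ F : ℝ → ℝ≥0∞, Measurable F → ∫⁻ y, F y ∂unnormKernel ρ σ c z =
        ∫⁻ y, ENNReal.ofReal (likelihood c y) * F y ∂transition ρ σ z := fun F hF => by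
      rw [unnormKernel, Kernel.lintegral_withDensity _ hGu _ hF]
    have hpow : (unnormKernel ρ σ c ^ (k + 1) : Kernel ℝ ℝ) z =
        (unnormKernel ρ σ c z).bind (unnormKernel ρ σ c ^ k : Kernel ℝ ℝ) := by
      rw [pow_succ]
      exact Kernel.comp_apply _ _ _
    have hψ : Measurable fun y => ∫⁻ x, φ x
        ∂gaussianReal (slope ρ (σ ^ 2) c k * y) (spread ρ (σ ^ 2) c k).toNNReal := by
      have hm : Measurable fun y : ℝ =>
          gaussianReal (slope ρ (σ ^ 2) c k * y) (spread ρ (σ ^ 2) c k).toNNReal :=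
        measurable_gaussianReal.comp (by fun_prop :
          Measurable fun y : ℝ => (slope ρ (σ ^ 2) c k * y, (spread ρ (σ ^ 2) c k).toNNReal))
      exact (Measure.measurable_lintegral hφ).comp hm
    have hvar : ((σ ^ 2).toNNReal : ℝ) = σ ^ 2 := Real.coe_toNNReal _ hs.le
    rw [hpow, Measure.lintegral_bind (Kernel.aemeasurable _) hφ.aemeasurable,
      hQ _ hQφ]
    have e1 : ∀ y, ENNReal.ofReal (likelihood c y) *
        ∫⁻ x, φ x ∂(unnormKernel ρ σ c ^ k : Kernel ℝ ℝ) y =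
        ENNReal.ofReal A * (ENNReal.ofReal (likelihood p y) * ∫⁻ x, φ x
          ∂gaussianReal (slope ρ (σ ^ 2) c k * y) (spread ρ (σ ^ 2) c k).toNNReal) := by
      intro y
      rw [ih y φ hφ, ENNReal.ofReal_mul hA.le, mul_assoc]
    simp_rw [e1]
    rw [lintegral_const_mul' _ _ ENNReal.ofReal_ne_top]
    change _ * (_ * ∫⁻ y, _ ∂gaussianReal (ρ * z) (σ ^ 2).toNNReal) = _
    rw [lintegral_likelihood_mul_gaussianReal _ _ hp0.le hψ,
      lintegral_gaussianReal_gaussianReal _ _ _ _ hφ, hvar, ← mul_assoc, ← mul_assoc,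
      ← ENNReal.ofReal_mul (likelihood_pos _ _).le, ← ENNReal.ofReal_mul
        (mul_nonneg (likelihood_pos _ _).le hA.le)]
    congr 2
    · rw [precision, ← hp]
      simp only [← likelihood_mul]
      have e2 : likelihood (p / (1 + p * σ ^ 2)) (ρ * z) =
          likelihood (ρ ^ 2 * p / (1 + p * σ ^ 2)) z := by
        unfold likelihood
        congr 1
        field_simp
      rw [e2]
      ring
    · rw [slope, spread, ← hp]
      congr 1
      · field_simp
      · rw [Real.toNNReal_add (spread_nonneg hs hc k) (by positivity),
          Real.toNNReal_mul (by positivity), Real.toNNReal_div hs.le]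

lemma measurable_cdf_gaussianReal (m a : ℝ) (v : NNReal) :
    Measurable fun z => cdf (gaussianReal (m * z) v) a := by
  simp_rw [cdf_gaussianReal_eq (m * _)]
  exact (monotone_cdf _).measurable.comp (by fun_prop)

lemma normalizeMeasure_smul {a : ℝ≥0∞} (ha : a ≠ 0) (ha' : a ≠ ∞) (μ : Measure ℝ) :
    normalizeMeasure (a • μ) = normalizeMeasure μ := by
  rw [normalizeMeasure, normalizeMeasure, smul_smul, Measure.smul_apply, smul_eq_mul,
    ENNReal.mul_inv (Or.inl ha) (Or.inl ha'), mul_right_comm, ENNReal.inv_mul_cancel ha ha',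
    one_mul]

/-- The distribution obtained from a predictive distribution `μ` by one updating step and `k`
further prediction and updating steps. -/
def propagate (ρ σ c : ℝ) (k : ℕ) (μ : Measure ℝ) : Measure ℝ :=
  normalizeMeasure ((μ.withDensity fun x => ENNReal.ofReal (likelihood c x)).bind
    (unnormKernel ρ σ c ^ k : Kernel ℝ ℝ))

section Update

variable {c : ℝ} (hc : 0 < c) (μ : Measure ℝ) [IsProbabilityMeasure μ]

include hc

lemma withDensity_likelihood_univ :
    (μ.withDensity fun x => ENNReal.ofReal (likelihood c x)) Set.univ =
      ENNReal.ofReal (∫ x, likelihood c x ∂μ) := by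
  rw [withDensity_apply _ MeasurableSet.univ, Measure.restrict_univ, lintegral_likelihood hc.le]

lemma normalizeMeasure_withDensity_likelihood :
    ∃ a : ℝ≥0∞, a ≠ 0 ∧ a ≠ ∞ ∧
      normalizeMeasure (μ.withDensity fun x => ENNReal.ofReal (likelihood c x)) =
        a • μ.withDensity fun x => ENNReal.ofReal (likelihood c x) := by
  refine ⟨_, ?_, ?_, rfl⟩
  · rw [withDensity_likelihood_univ hc]
    simp
  · rw [withDensity_likelihood_univ hc]
    simpa using integral_likelihood_pos hc.le μ

end Update

lemma propagate_zero (ρ σ c : ℝ) (μ : Measure ℝ) : propagate ρ σ c 0 μ =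
    normalizeMeasure (μ.withDensity fun x => ENNReal.ofReal (likelihood c x)) := by
  rw [propagate, pow_zero]
  change normalizeMeasure (Measure.bind _ Kernel.id) = _
  rw [Kernel.id, Kernel.deterministic]
  congr 1
  exact Measure.bind_dirac

lemma filterDist_eq_propagate {c : ℝ} (hc : 0 < c) (ρ σ : ℝ) (η₁ : Measure ℝ)
    [IsProbabilityMeasure η₁] (t : ℕ) : filterDist ρ σ c η₁ t = propagate ρ σ c t η₁ := by
  obtain ⟨a, ha, ha', h⟩ := normalizeMeasure_withDensity_likelihood hc η₁
  rw [filterDist, propagate, filterInit, h, Measure.bind_smul, normalizeMeasure_smul ha ha']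

lemma withDensity_bind_transition (ρ σ c : ℝ) (ν : Measure ℝ) :
    ((ν.bind (transition ρ σ)).withDensity fun x => ENNReal.ofReal (likelihood c x)) =
      ν.bind (unnormKernel ρ σ c) := by
  have hG : Measurable fun x => ENNReal.ofReal (likelihood c x) :=
    (measurable_likelihood c).ennreal_ofReal
  have hGu : Measurable (Function.uncurry fun (_ : ℝ) x => ENNReal.ofReal (likelihood c x)) :=
    hG.comp measurable_snd
  ext s hs
  rw [withDensity_apply _ hs, ← lintegral_indicator hs,
    Measure.lintegral_bind (Kernel.aemeasurable _) (hG.indicator hs).aemeasurable,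
    Measure.bind_apply hs (Kernel.aemeasurable _)]
  refine lintegral_congr fun z => ?_
  rw [unnormKernel, Kernel.withDensity_apply' _ hGu, lintegral_indicator hs]

/-- The semigroup property: prediction followed by reweighting is the kernel Q, and the intermediate
normalization cancels. -/
lemma propagate_bind_transition {c : ℝ} (hc : 0 < c) (ρ σ : ℝ) (k : ℕ) (μ : Measure ℝ)
    [IsProbabilityMeasure μ] :
    propagate ρ σ c k ((propagate ρ σ c 0 μ).bind (transition ρ σ)) =
      propagate ρ σ c (k + 1) μ := by
  obtain ⟨a, ha, ha', h⟩ := normalizeMeasure_withDensity_likelihood hc μ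
  rw [propagate_zero, h, propagate, withDensity_bind_transition, Measure.bind_smul,
    Measure.bind_smul, normalizeMeasure_smul ha ha', propagate, pow_succ]
  congr 1
  exact Measure.comp_assoc

section Formula

variable {ρ σ c : ℝ} (hσ : 0 < σ) (hc : 0 < c) (μ : Measure ℝ) [IsProbabilityMeasure μ] (k : ℕ)

include hσ hc

lemma lintegral_propagate {φ : ℝ → ℝ≥0∞} (hφ : Measurable φ) :
    ∫⁻ x, φ x ∂propagate ρ σ c k μ =
      (ENNReal.ofReal (∫ z, likelihood (precision ρ (σ ^ 2) c k) z ∂μ))⁻¹ *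
        ∫⁻ z, ENNReal.ofReal (likelihood (precision ρ (σ ^ 2) c k) z) *
          ∫⁻ x, φ x ∂gaussianReal (slope ρ (σ ^ 2) c k * z) (spread ρ (σ ^ 2) c k).toNNReal ∂μ := by
  obtain ⟨A, hA, h⟩ := likelihood_mul_lintegral_unnormKernel_pow (ρ := ρ) hσ hc k
  have hp : 0 < precision ρ (σ ^ 2) c k := precision_pos (by positivity) hc k
  have key : ∀ φ : ℝ → ℝ≥0∞, Measurable φ →
      ∫⁻ x, φ x ∂((μ.withDensity fun x => ENNReal.ofReal (likelihood c x)).bind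
        (unnormKernel ρ σ c ^ k : Kernel ℝ ℝ)) = ENNReal.ofReal A *
        ∫⁻ z, ENNReal.ofReal (likelihood (precision ρ (σ ^ 2) c k) z) *
          ∫⁻ x, φ x ∂gaussianReal (slope ρ (σ ^ 2) c k * z)
            (spread ρ (σ ^ 2) c k).toNNReal ∂μ := by
    intro φ hφ
    rw [Measure.lintegral_bind (Kernel.aemeasurable _) hφ.aemeasurable,
      lintegral_withDensity_eq_lintegral_mul _ (measurable_likelihood c).ennreal_ofReal
        hφ.lintegral_kernel, ← lintegral_const_mul' _ _ ENNReal.ofReal_ne_top]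
    refine lintegral_congr fun z => ?_
    rw [Pi.mul_apply, h z φ hφ, ENNReal.ofReal_mul hA.le, mul_assoc]
  have hA0 : ENNReal.ofReal A ≠ 0 := by simpa using hA
  rw [propagate, normalizeMeasure, lintegral_smul_measure, key φ hφ, ← lintegral_one,
    key _ measurable_const]
  simp only [lintegral_one, measure_univ, mul_one]
  rw [lintegral_likelihood hp.le, ENNReal.mul_inv (Or.inl hA0) (Or.inl ENNReal.ofReal_ne_top),
    smul_eq_mul, mul_comm (ENNReal.ofReal A)⁻¹, mul_assoc, ← mul_assoc (ENNReal.ofReal A)⁻¹,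
    ENNReal.inv_mul_cancel hA0 ENNReal.ofReal_ne_top, one_mul]

lemma isProbabilityMeasure_propagate : IsProbabilityMeasure (propagate ρ σ c k μ) := by
  have hp : 0 < precision ρ (σ ^ 2) c k := precision_pos (by positivity) hc k
  constructor
  rw [← lintegral_one, lintegral_propagate hσ hc μ k measurable_const]
  simp only [lintegral_one, measure_univ, mul_one]
  rw [lintegral_likelihood hp.le]
  exact ENNReal.inv_mul_cancel (by simpa using integral_likelihood_pos hp.le μ)
    ENNReal.ofReal_ne_top

lemma cdf_propagate (a : ℝ) :
    cdf (propagate ρ σ c k μ) a =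
      (∫ z, likelihood (precision ρ (σ ^ 2) c k) z *
        cdf (gaussianReal (slope ρ (σ ^ 2) c k * z) (spread ρ (σ ^ 2) c k).toNNReal) a ∂μ) /
        ∫ z, likelihood (precision ρ (σ ^ 2) c k) z ∂μ := by
  have hp : 0 < precision ρ (σ ^ 2) c k := precision_pos (by positivity) hc k
  have := isProbabilityMeasure_propagate (ρ := ρ) hσ hc μ k
  rw [cdf_eq_real, measureReal_def, ← lintegral_indicator_one measurableSet_Iic,
    lintegral_propagate hσ hc μ k (measurable_one.indicator measurableSet_Iic), ENNReal.toReal_mul,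
    ENNReal.toReal_inv, ENNReal.toReal_ofReal (integral_likelihood_pos hp.le μ).le,
    div_eq_inv_mul]
  congr 1
  simp only [lintegral_indicator_one measurableSet_Iic, ← ofReal_cdf]
  rw [integral_eq_lintegral_of_nonneg_ae]
  · simp_rw [ENNReal.ofReal_mul (likelihood_pos _ _).le]
  · exact .of_forall fun z => mul_nonneg (likelihood_pos _ _).le (cdf_nonneg _ _)
  · exact ((measurable_likelihood _).mul (measurable_cdf_gaussianReal _ _ _)).aestronglyMeasurable

/-- Uniform lower bound for Gaussian functionals of the filtering distributions. -/
lemma le_integral_likelihood_propagate :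
    (√(1 + (c + ρ ^ 2 / σ ^ 2) * c⁻¹))⁻¹ *
      ∫ z, likelihood ((c + ρ ^ 2 / σ ^ 2) + (c + ρ ^ 2 / σ ^ 2) * ((c + ρ ^ 2 / σ ^ 2) / c)) z ∂μ ≤
    ∫ x, likelihood (c + ρ ^ 2 / σ ^ 2) x ∂propagate ρ σ c k μ := by
  have hs : 0 < σ ^ 2 := by positivity
  have hp : 0 < precision ρ (σ ^ 2) c k := precision_pos hs hc k
  have hpP := precision_le (ρ := ρ) hs hc k
  have hm := slope_sq_le_div (ρ := ρ) hs hc k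
  have hv := spread_le (ρ := ρ) hs hc k
  have hv0 := spread_nonneg (ρ := ρ) hs hc k
  set P := c + ρ ^ 2 / σ ^ 2
  have hP : 0 < P := hp.trans_le hpP
  set p := precision ρ (σ ^ 2) c k
  set m := slope ρ (σ ^ 2) c k
  set v := spread ρ (σ ^ 2) c k
  have := isProbabilityMeasure_propagate (ρ := ρ) hσ hc μ k
  -- The exponents add up: the weight has precision p ≤ P, and integrating the Gaussian function of
  -- precision P against 𝒩(m z, v) contributes at most P m² ≤ P · P/c.
  set R := P + P * (P / c)
  have hR : 0 < R := by positivity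
  rw [← ENNReal.ofReal_le_ofReal_iff (integral_nonneg fun x => (likelihood_pos _ _).le),
    ← lintegral_likelihood hP.le,
    lintegral_propagate hσ hc μ k (measurable_likelihood P).ennreal_ofReal,
    ENNReal.ofReal_mul (by positivity), ← lintegral_likelihood hR.le,
    ← lintegral_const_mul' _ _ ENNReal.ofReal_ne_top]
  -- The normalizing integral is at most 1, so it can be dropped from a lower bound.
  have hle1 : (1 : ℝ≥0∞) ≤ (ENNReal.ofReal (∫ z, likelihood p z ∂μ))⁻¹ := by
    rw [ENNReal.one_le_inv, ENNReal.ofReal_le_one]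
    exact integral_likelihood_le_one hp.le μ
  refine le_trans ?_ (le_mul_of_one_le_left zero_le hle1)
  refine lintegral_mono fun z => ?_
  rw [lintegral_likelihood_gaussianReal _ _ hP.le, Real.coe_toNNReal _ hv0,
    ← ENNReal.ofReal_mul (by positivity), ← ENNReal.ofReal_mul (likelihood_pos _ _).le]
  apply ENNReal.ofReal_le_ofReal
  rw [← likelihood_mul]
  have h1 : likelihood P z ≤ likelihood p z := likelihood_anti hpP z
  have h2 : (√(1 + P * c⁻¹))⁻¹ ≤ (√(1 + P * v))⁻¹ := by gcongr
  have h3 : likelihood (P * (P / c)) z ≤ likelihood (P / (1 + P * v)) (m * z) := by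
    rw [likelihood, likelihood, Real.exp_le_exp]
    have h4 : P / (1 + P * v) ≤ P := div_le_self hP.le (by nlinarith)
    have h5 : m ^ 2 ≤ P / c := hm.trans (by gcongr)
    have h6 : P / (1 + P * v) * m ^ 2 ≤ P * (P / c) := by gcongr
    nlinarith [mul_le_mul_of_nonneg_right h6 (sq_nonneg z)]
  calc _ = likelihood P z * ((√(1 + P * c⁻¹))⁻¹ * likelihood (P * (P / c)) z) := by ring
    _ ≤ _ := by
      have := (likelihood_pos (P * (P / c)) z).le
      have := (likelihood_pos p z).le
      gcongr

end Formula

/-- Lower bound for Gaussian functionals after a prediction step. -/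
lemma le_integral_likelihood_bind {ρ σ c : ℝ} (hσ : 0 < σ) (hc : 0 < c) (ν : Measure ℝ)
    [IsProbabilityMeasure ν] :
    (√(1 + (c + ρ ^ 2 / σ ^ 2) * σ ^ 2))⁻¹ * ∫ z, likelihood (c + ρ ^ 2 / σ ^ 2) z ∂ν ≤
      ∫ z, likelihood (c + ρ ^ 2 / σ ^ 2) z ∂ν.bind (transition ρ σ) := by
  have hs : 0 < σ ^ 2 := by positivity
  set P := c + ρ ^ 2 / σ ^ 2 with hPdef
  have hP : 0 < P := by positivity
  rw [← ENNReal.ofReal_le_ofReal_iff (integral_nonneg fun x => (likelihood_pos _ _).le),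
    ← lintegral_likelihood hP.le,
    Measure.lintegral_bind (Kernel.aemeasurable _)
      (measurable_likelihood P).ennreal_ofReal.aemeasurable,
    ENNReal.ofReal_mul (by positivity), ← lintegral_likelihood hP.le,
    ← lintegral_const_mul' _ _ ENNReal.ofReal_ne_top]
  refine lintegral_mono fun z => ?_
  change _ ≤ ∫⁻ x, ENNReal.ofReal (likelihood P x) ∂gaussianReal (ρ * z) (σ ^ 2).toNNReal
  rw [lintegral_likelihood_gaussianReal _ _ hP.le, Real.coe_toNNReal _ hs.le,
    ← ENNReal.ofReal_mul (by positivity)]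
  apply ENNReal.ofReal_le_ofReal
  gcongr ?_ * ?_
  rw [likelihood, likelihood, Real.exp_le_exp]
  -- By the choice of P, ρ² = (P - c) σ²; hence a prediction step does not push the precision above
  -- P.
  have h1 : P / (1 + P * σ ^ 2) * ρ ^ 2 ≤ P := by
    rw [div_mul_eq_mul_div, div_le_iff₀ (by positivity)]
    have h2 : ρ ^ 2 = (P - c) * σ ^ 2 := by rw [hPdef]; field_simp; ring
    rw [h2]
    nlinarith [mul_pos (mul_pos hP hc) hs]
  nlinarith [mul_le_mul_of_nonneg_right h1 (sq_nonneg z)]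

-- Expresses the algorithm's reweighting through the same semigroup as the exact filter, so that
-- stability applies to both.
open Finset in
lemma weightedEmpirical_eq_propagate (ρ σ c : ℝ) {N : ℕ} (hN : 1 ≤ N)
    (x : Fin N → ℝ) : weightedEmpirical c x = propagate ρ σ c 0 (empirical x) := by
  have := isProbabilityMeasure_empirical hN x
  have hN0 : (0 : ℝ) < N := by exact_mod_cast hN
  have : Nonempty (Fin N) := ⟨⟨0, hN⟩⟩
  have hS : 0 < ∑ m, likelihood c (x m) :=
    sum_pos (fun n _ => likelihood_pos _ _) univ_nonempty
  have hlin : ∀ f : ℝ → ℝ≥0∞, Measurable f →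
      ∫⁻ y, f y ∂empirical x = ENNReal.ofReal (1 / N) * ∑ n, f (x n) := by
    intro f hf
    rw [empirical, lintegral_finsetSum_measure, mul_sum]
    refine sum_congr rfl fun n _ => ?_
    rw [lintegral_smul_measure, lintegral_dirac' _ hf, smul_eq_mul]
  have hG : Measurable fun x => ENNReal.ofReal (likelihood c x) :=
    (measurable_likelihood c).ennreal_ofReal
  rw [propagate_zero, normalizeMeasure]
  ext s hs
  rw [Measure.smul_apply, withDensity_apply _ hs, withDensity_apply _ MeasurableSet.univ,
    Measure.restrict_univ, ← lintegral_indicator hs, hlin _ hG, hlin _ (hG.indicator hs),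
    smul_eq_mul, weightedEmpirical, Measure.coe_finsetSum, Finset.sum_apply,
    ← ENNReal.ofReal_sum_of_nonneg (fun n _ => (likelihood_pos _ _).le),
    ENNReal.mul_inv (Or.inr ENNReal.ofReal_ne_top) (Or.inl ENNReal.ofReal_ne_top), mul_mul_mul_comm,
    ENNReal.inv_mul_cancel (by simpa using hN0.ne') ENNReal.ofReal_ne_top, one_mul, mul_sum]
  refine sum_congr rfl fun n _ => ?_
  rw [Measure.smul_apply, Measure.dirac_apply' _ hs, smul_eq_mul, div_eq_inv_mul,
    ENNReal.ofReal_mul (by positivity), ENNReal.ofReal_inv_of_pos hS, mul_assoc]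
  simp only [Set.indicator, Pi.one_apply]
  split_ifs <;> simp

/-! ### Integrals of functions of bounded variation -/

/-- Integration by parts through Fubini on {x ≤ t}, whose section at t has mass F_μ(t). -/
lemma integral_setIntegral_Ici_eq (μ : Measure ℝ) [IsProbabilityMeasure μ] {φ : ℝ → ℝ}
    (hφ : Integrable φ) :
    Integrable (fun x => ∫ t in Set.Ici x, φ t) μ ∧
      ∫ x, (∫ t in Set.Ici x, φ t) ∂μ = ∫ t, cdf μ t * φ t := by
  have hms : MeasurableSet {q : ℝ × ℝ | q.1 ≤ q.2} := measurableSet_le measurable_fst measurable_snd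
  have hi : Integrable (Function.uncurry fun x t => (Set.Ici x).indicator φ t) (μ.prod volume) := by
    refine ((hφ.comp_snd μ).indicator hms).congr (.of_forall fun q => ?_)
    simp [Set.indicator, Function.uncurry]
  have e : ∀ x, ∫ t in Set.Ici x, φ t = ∫ t, (Set.Ici x).indicator φ t := fun x =>
    (integral_indicator measurableSet_Ici).symm
  simp_rw [e]
  refine ⟨hi.integral_prod_left, ?_⟩
  rw [integral_integral_swap hi]
  refine integral_congr_ae (.of_forall fun t => ?_)
  have e2 : ∀ x, (Set.Ici x).indicator φ t = (Set.Iic t).indicator (fun _ => φ t) x := by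
    intro x
    simp [Set.indicator]
  simp only [e2]
  rw [integral_indicator_const _ measurableSet_Iic, cdf_eq_real, smul_eq_mul]

lemma integrable_cdf_mul (μ : Measure ℝ) {φ : ℝ → ℝ} (hφ : Integrable φ) :
    Integrable fun t => cdf μ t * φ t :=
  hφ.bdd_mul (monotone_cdf μ).measurable.aestronglyMeasurable (.of_forall fun t => by
    rw [Real.norm_of_nonneg (cdf_nonneg μ t)]
    exact cdf_le_one μ t)

/-- Comparison of integrals with respect to two probability measures by means of the Kolmogorov
distance. -/
lemma abs_integral_sub_le_kolmogorovDist (μ ν : Measure ℝ) [IsProbabilityMeasure μ]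
    [IsProbabilityMeasure ν] {φ κ : ℝ → ℝ} (hφ : Integrable φ) (hκ : Integrable κ)
    (hφκ : ∀ x, |φ x| ≤ κ x) (l b a : ℝ) {f : ℝ → ℝ}
    (hf : ∀ x, f x = l + (Set.Iic a).indicator (fun _ => b) x + ∫ t in Set.Ici x, φ t) :
    |∫ x, f x ∂μ - ∫ x, f x ∂ν| ≤ (|b| + ∫ x, κ x) * kolmogorovDist μ ν := by
  have key : ∀ (π : Measure ℝ) [IsProbabilityMeasure π],
      ∫ x, f x ∂π = l + cdf π a * b + ∫ t, cdf π t * φ t := by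
    intro π _
    obtain ⟨h1, h2⟩ := integral_setIntegral_Ici_eq π hφ
    have h3 : Integrable ((Set.Iic a).indicator fun _ => b) π :=
      (integrable_const b).indicator measurableSet_Iic
    have h4 : Integrable (fun x => l + (Set.Iic a).indicator (fun _ => b) x) π :=
      (integrable_const l).add h3
    simp_rw [hf]
    rw [integral_add h4 h1, integral_add (integrable_const l) h3, h2,
      integral_indicator_const _ measurableSet_Iic, cdf_eq_real]
    simp
  rw [key μ, key ν]
  have e : (l + cdf μ a * b + ∫ t, cdf μ t * φ t) - (l + cdf ν a * b + ∫ t, cdf ν t * φ t) =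
      (cdf μ a - cdf ν a) * b + ∫ t, (cdf μ t * φ t - cdf ν t * φ t) := by
    rw [integral_sub (integrable_cdf_mul μ hφ) (integrable_cdf_mul ν hφ)]
    ring
  rw [e, add_mul]
  refine (abs_add_le _ _).trans (add_le_add ?_ ?_)
  · rw [abs_mul, mul_comm]
    exact mul_le_mul_of_nonneg_left (abs_cdf_sub_le_kolmogorovDist μ ν a) (abs_nonneg b)
  · rw [← Real.norm_eq_abs, ← integral_mul_const]
    refine norm_integral_le_of_norm_le (hκ.mul_const _) (.of_forall fun t => ?_)
    rw [← sub_mul, Real.norm_eq_abs, abs_mul, mul_comm]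
    exact mul_le_mul (hφκ t) (abs_cdf_sub_le_kolmogorovDist μ ν t) (abs_nonneg _)
      ((abs_nonneg _).trans (hφκ t))

lemma integrable_of_hasDerivAt_of_le {f f' κ : ℝ → ℝ} (hf : ∀ x, HasDerivAt f (f' x) x)
    (hκ : Integrable κ) (hle : ∀ x, |f' x| ≤ κ x) : Integrable f' := by
  have : f' = deriv f := funext fun x => (hf x).deriv.symm
  refine hκ.mono' ?_ (.of_forall hle)
  rw [this]
  exact (measurable_deriv f).aestronglyMeasurable

lemma abs_integral_sub_le_of_hasDerivAt (μ ν : Measure ℝ) [IsProbabilityMeasure μ]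
    [IsProbabilityMeasure ν] {f f' κ : ℝ → ℝ} (hf : ∀ x, HasDerivAt f (f' x) x)
    (hκ : Integrable κ) (hle : ∀ x, |f' x| ≤ κ x) {l : ℝ}
    (hl : Filter.Tendsto f Filter.atTop (nhds l)) :
    |∫ x, f x ∂μ - ∫ x, f x ∂ν| ≤ (∫ x, κ x) * kolmogorovDist μ ν := by
  have hf' := integrable_of_hasDerivAt_of_le hf hκ hle
  have := abs_integral_sub_le_kolmogorovDist μ ν (φ := fun x => -f' x) (κ := κ) hf'.neg hκ
    (fun x => by rw [abs_neg]; exact hle x) l 0 0 (f := f) (fun x => by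
      rw [integral_Ici_eq_integral_Ioi, integral_neg,
        integral_Ioi_of_hasDerivAt_of_tendsto' (fun y _ => hf y) hf'.integrableOn hl]
      simp)
  simpa using this

/-! ### Estimates for Gaussian functions -/

lemma hasDerivAt_cdf_gaussianReal (m : ℝ) {v : NNReal} (hv : v ≠ 0) (x : ℝ) :
    HasDerivAt (cdf (gaussianReal m v)) (gaussianPDFReal m v x) x := by
  have hint := integrable_gaussianPDFReal m v
  have hcdf : ∀ y, cdf (gaussianReal m v) y = ∫ t in Set.Iic y, gaussianPDFReal m v t := by
    intro y
    rw [cdf_eq_real, measureReal_def, gaussianReal_apply_eq_integral _ hv, ENNReal.toReal_ofReal]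
    exact integral_nonneg fun t => gaussianPDFReal_nonneg _ _ _
  have heq : (cdf (gaussianReal m v) : ℝ → ℝ) = fun y =>
      cdf (gaussianReal m v) x + ∫ t in x..y, gaussianPDFReal m v t := by
    ext y
    rw [← intervalIntegral.integral_Iic_sub_Iic hint.integrableOn hint.integrableOn, ← hcdf,
      ← hcdf]
    ring
  rw [heq]
  refine (intervalIntegral.integral_hasDerivAt_right (by simp)
    (stronglyMeasurable_gaussianPDFReal m v).stronglyMeasurableAtFilter ?_).const_add _
  unfold gaussianPDFReal
  fun_prop

lemma gaussianPDFReal_le (m : ℝ) (v : NNReal) (x : ℝ) :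
    gaussianPDFReal m v x ≤ (√(2 * Real.pi * v))⁻¹ := by
  rw [gaussianPDFReal]
  refine mul_le_of_le_one_right (by positivity) (Real.exp_le_one_iff.2 ?_)
  have : 0 ≤ (x - m) ^ 2 / (2 * v) := by positivity
  rw [neg_div]
  linarith

lemma abs_cdf_gaussianReal_sub_le (m : ℝ) {v : NNReal} (hv : v ≠ 0) (x y : ℝ) :
    |cdf (gaussianReal m v) y - cdf (gaussianReal m v) x| ≤ (√(2 * Real.pi * v))⁻¹ * |y - x| :=
  Convex.norm_image_sub_le_of_norm_hasDerivWithin_le (s := Set.univ)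
    (fun z _ => (hasDerivAt_cdf_gaussianReal m hv z).hasDerivWithinAt)
    (fun z _ => by
      rw [Real.norm_of_nonneg (gaussianPDFReal_nonneg _ _ _)]
      exact gaussianPDFReal_le m v z) convex_univ (Set.mem_univ _) (Set.mem_univ _)

/-- The prediction step does not increase the Kolmogorov distance. -/
lemma kolmogorovDist_bind_transition_le (ρ : ℝ) {σ : ℝ} (hσ : 0 < σ) (μ ν : Measure ℝ)
    [IsProbabilityMeasure μ] [IsProbabilityMeasure ν] :
    kolmogorovDist (μ.bind (transition ρ σ)) (ν.bind (transition ρ σ)) ≤ kolmogorovDist μ ν := by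
  refine kolmogorovDist_le fun a => ?_
  rw [cdf_bind, cdf_bind]
  simp only [cdf_transition]
  have hv : (σ ^ 2).toNNReal ≠ 0 := by simpa using hσ.ne'
  set v := (σ ^ 2).toNNReal
  rcases eq_or_ne ρ 0 with rfl | hρ
  · simpa using kolmogorovDist_nonneg μ ν
  have hderiv : ∀ z, HasDerivAt (fun z => cdf (gaussianReal 0 v) (a - ρ * z))
      (gaussianPDFReal 0 v (a - ρ * z) * (-ρ)) z := by
    intro z
    have h1 : HasDerivAt (fun z => a - ρ * z) (-ρ) z := by
      simpa using ((hasDerivAt_id z).const_mul ρ).const_sub a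
    exact (hasDerivAt_cdf_gaussianReal 0 hv (a - ρ * z)).comp z h1
  have hlim : ∃ l, Filter.Tendsto (fun z => cdf (gaussianReal 0 v) (a - ρ * z)) Filter.atTop
      (nhds l) := by
    rcases lt_or_gt_of_ne hρ with h | h
    · refine ⟨1, (tendsto_cdf_atTop _).comp ?_⟩
      simp_rw [sub_eq_add_neg, ← neg_mul]
      exact Filter.tendsto_atTop_add_const_left _ _
        (Filter.tendsto_id.const_mul_atTop (by linarith))
    · refine ⟨0, (tendsto_cdf_atBot _).comp ?_⟩
      simp_rw [sub_eq_add_neg, ← neg_mul]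
      exact Filter.tendsto_atBot_add_const_left _ _
        (Filter.tendsto_id.const_mul_atTop_of_neg (by linarith))
  obtain ⟨l, hl⟩ := hlim
  have hint : Integrable fun z => gaussianPDFReal 0 v (a - ρ * z) * |ρ| :=
    (((integrable_gaussianPDFReal 0 v).comp_sub_left a).comp_mul_left' hρ).mul_const _
  -- The constant is the total variation of z ↦ Γ(a - ρ z), Γ being the cdf of 𝒩(0, σ²).
  have hone : ∫ z, gaussianPDFReal 0 v (a - ρ * z) * |ρ| = 1 := by
    rw [integral_mul_const, Measure.integral_comp_mul_left (fun y => gaussianPDFReal 0 v (a - y)),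
      integral_sub_left_eq_self (gaussianPDFReal 0 v) volume a,
      integral_gaussianPDFReal_eq_one 0 hv, smul_eq_mul, mul_one, abs_inv,
      inv_mul_cancel₀ (abs_ne_zero.2 hρ)]
  have := abs_integral_sub_le_of_hasDerivAt μ ν hderiv hint (fun z => by
    rw [abs_mul, abs_neg, abs_of_nonneg (gaussianPDFReal_nonneg _ _ _)]) hl
  rwa [hone, one_mul] at this

lemma hasDerivAt_likelihood (p x : ℝ) : HasDerivAt (likelihood p) (-(p * x * likelihood p x)) x := by
  have h := ((hasDerivAt_pow 2 x).const_mul (-p)).div_const 2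
  have e : -(p * x * likelihood p x) =
      Real.exp (-p * x ^ 2 / 2) * (-p * (((2 : ℕ) : ℝ) * x ^ (2 - 1)) / 2) := by
    rw [likelihood]
    push_cast
    ring
  rw [e]
  exact h.exp

/-- Half of the exponent absorbs the polynomial, since 1 + y ≤ exp y at y = c x²/4. -/
lemma one_add_sq_mul_likelihood_le {c : ℝ} (hc : 0 < c) (x : ℝ) :
    (1 + x ^ 2) * likelihood c x ≤ (1 + 4 / c) * likelihood (c / 2) x := by
  have e : likelihood c x = likelihood (c / 2) x * likelihood (c / 2) x := by
    rw [likelihood_mul]; ring_nf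
  have h1 : 1 + c / 4 * x ^ 2 ≤ Real.exp (c / 4 * x ^ 2) := by
    have := Real.add_one_le_exp (c / 4 * x ^ 2)
    linarith
  have h2 : likelihood (c / 2) x * Real.exp (c / 4 * x ^ 2) = 1 := by
    rw [likelihood, ← Real.exp_add, Real.exp_eq_one_iff]
    ring
  have h0 := likelihood_pos (c / 2) x
  have h3 : 1 + x ^ 2 ≤ (1 + 4 / c) * (1 + c / 4 * x ^ 2) := by
    have : (1 + 4 / c) * (1 + c / 4 * x ^ 2) = 1 + x ^ 2 + (4 / c + c / 4 * x ^ 2) := by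
      field_simp
      ring
    rw [this]
    have : 0 ≤ 4 / c + c / 4 * x ^ 2 := by positivity
    linarith
  rw [e, ← mul_assoc]
  refine mul_le_mul_of_nonneg_right ?_ h0.le
  calc (1 + x ^ 2) * likelihood (c / 2) x
      ≤ (1 + 4 / c) * (1 + c / 4 * x ^ 2) * likelihood (c / 2) x := by gcongr
    _ ≤ (1 + 4 / c) * Real.exp (c / 4 * x ^ 2) * likelihood (c / 2) x := by gcongr
    _ = (1 + 4 / c) := by rw [mul_assoc, mul_comm (Real.exp _), h2, mul_one]

/-- A Gaussian function that dominates all derivatives that occur below. -/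
def envelope (c P : ℝ) (x : ℝ) : ℝ := (1 + P) * ((1 + 4 / c) * likelihood (c / 2) x)

section Envelope

variable {c p P : ℝ}

lemma le_envelope (hc : 0 < c) (hcp : c ≤ p) (hpP : p ≤ P) (x : ℝ) :
    (1 + P) * ((1 + x ^ 2) * likelihood p x) ≤ envelope c P x := by
  have hP : 0 < 1 + P := by linarith
  refine mul_le_mul_of_nonneg_left (le_trans ?_ (one_add_sq_mul_likelihood_le hc x)) hP.le
  exact mul_le_mul_of_nonneg_left (likelihood_anti hcp x) (by positivity)

lemma integrable_envelope (hc : 0 < c) : Integrable (envelope c P) := by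
  refine (Integrable.const_mul ?_ _).const_mul _
  refine (integrable_exp_neg_mul_sq (b := c / 4) (by positivity)).congr (.of_forall fun x => ?_)
  simp only [likelihood]
  ring_nf

lemma envelope_nonneg (hc : 0 < c) (hP : 0 ≤ P) (x : ℝ) : 0 ≤ envelope c P x := by
  have := likelihood_pos (c / 2) x
  unfold envelope
  positivity

lemma abs_deriv_likelihood_le (hc : 0 < c) (hcp : c ≤ p) (hpP : p ≤ P) (x : ℝ) :
    |-(p * x * likelihood p x)| ≤ envelope c P x := by
  refine le_trans ?_ (le_envelope hc hcp hpP x)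
  have hp : 0 < p := by linarith
  have h0 := likelihood_pos p x
  rw [abs_neg, abs_mul, abs_mul, abs_of_pos hp, abs_of_pos h0, ← mul_assoc]
  refine mul_le_mul_of_nonneg_right ?_ h0.le
  have h1 : |x| ≤ 1 + x ^ 2 := by nlinarith [sq_nonneg (|x| - 1), sq_abs x, abs_nonneg x]
  exact mul_le_mul (by linarith) h1 (abs_nonneg _) (by linarith)

lemma tendsto_likelihood_atTop (hp : 0 < p) :
    Filter.Tendsto (likelihood p) Filter.atTop (nhds 0) := by
  refine Real.tendsto_exp_atBot.comp ?_
  have e : (fun x : ℝ => -p * x ^ 2 / 2) = fun x => -(p / 2) * x ^ 2 := by ext x; ring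
  rw [e]
  exact (Filter.tendsto_pow_atTop two_ne_zero).const_mul_atTop_of_neg (by linarith)

variable (μ ν : Measure ℝ) [IsProbabilityMeasure μ] [IsProbabilityMeasure ν]

lemma abs_integral_likelihood_sub_le (hc : 0 < c) (hcp : c ≤ p) (hpP : p ≤ P) :
    |∫ x, likelihood p x ∂μ - ∫ x, likelihood p x ∂ν| ≤
      (∫ x, envelope c P x) * kolmogorovDist μ ν :=
  abs_integral_sub_le_of_hasDerivAt μ ν (hasDerivAt_likelihood p) (integrable_envelope hc)
    (abs_deriv_likelihood_le hc hcp hpP) (tendsto_likelihood_atTop (hc.trans_le hcp))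

/-- Truncation at `a` adds a jump of height at most 1 to the variation, whence the extra 1. -/
lemma abs_integral_likelihood_indicator_sub_le (hc : 0 < c) (hcp : c ≤ p) (hpP : p ≤ P) (a : ℝ) :
    |∫ x, (Set.Iic a).indicator (likelihood p) x ∂μ -
      ∫ x, (Set.Iic a).indicator (likelihood p) x ∂ν| ≤
      (1 + ∫ x, envelope c P x) * kolmogorovDist μ ν := by
  have hp : 0 < p := hc.trans_le hcp
  have hw' : Integrable fun x => -(p * x * likelihood p x) :=
    integrable_of_hasDerivAt_of_le (hasDerivAt_likelihood p) (integrable_envelope hc)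
      (abs_deriv_likelihood_le hc hcp hpP)
  have := abs_integral_sub_le_kolmogorovDist μ ν
    (φ := (Set.Iic a).indicator fun x => -(-(p * x * likelihood p x)))
    (hw'.neg.indicator measurableSet_Iic) (integrable_envelope (P := P) hc)
    (fun x => by
      simp only [Set.indicator]
      split_ifs
      · rw [abs_neg]; exact abs_deriv_likelihood_le hc hcp hpP x
      · rw [abs_zero]; exact envelope_nonneg hc (by linarith) x) 0 (likelihood p a) a
    (f := (Set.Iic a).indicator (likelihood p)) (fun x => by
      rw [setIntegral_indicator measurableSet_Iic, Set.Ici_inter_Iic]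
      rcases le_or_gt x a with h | h
      · rw [integral_Icc_eq_integral_Ioc, ← intervalIntegral.integral_of_le h,
          intervalIntegral.integral_neg, intervalIntegral.integral_eq_sub_of_hasDerivAt
            (fun y _ => hasDerivAt_likelihood p y) hw'.intervalIntegrable]
        simp [Set.indicator, h]
      · simp [Set.indicator, not_le.2 h])
  refine this.trans (mul_le_mul_of_nonneg_right ?_ (kolmogorovDist_nonneg μ ν))
  rw [abs_of_pos (likelihood_pos _ _)]
  exact add_le_add (likelihood_le_one hp.le a) le_rfl

end Envelope

lemma abs_div_sub_div_le {A B a b δ S : ℝ} (hδ : 0 < δ) (ha : δ ≤ a) (hb : δ ≤ b) (hB : |B| ≤ S) :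
    |A / a - B / b| ≤ |A - B| / δ + S * |a - b| / δ ^ 2 := by
  have ha0 : 0 < a := hδ.trans_le ha
  have hb0 : 0 < b := hδ.trans_le hb
  have e : A / a - B / b = (A - B) / a + B * (b - a) / (a * b) := by field_simp; ring
  rw [e]
  refine (abs_add_le _ _).trans (add_le_add ?_ ?_)
  · rw [abs_div, abs_of_pos ha0]
    gcongr
  · rw [abs_div, abs_mul, abs_of_pos (mul_pos ha0 hb0), abs_sub_comm b a, sq]
    have : 0 ≤ S := (abs_nonneg _).trans hB
    gcongr

section Ratio

variable {c p P δ : ℝ} (μ ν : Measure ℝ) [IsProbabilityMeasure μ] [IsProbabilityMeasure ν]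

/-- Stability of one updating step. -/
lemma abs_ratio_indicator_sub_le (hc : 0 < c) (hcp : c ≤ p) (hpP : p ≤ P) (hδ : 0 < δ)
    (hμ : δ ≤ ∫ x, likelihood p x ∂μ) (hν : δ ≤ ∫ x, likelihood p x ∂ν) (a : ℝ) :
    |(∫ x, (Set.Iic a).indicator (likelihood p) x ∂μ) / (∫ x, likelihood p x ∂μ) -
      (∫ x, (Set.Iic a).indicator (likelihood p) x ∂ν) / (∫ x, likelihood p x ∂ν)| ≤
      ((1 + ∫ x, envelope c P x) / δ + (∫ x, envelope c P x) / δ ^ 2) * kolmogorovDist μ ν := by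
  have hp : 0 < p := hc.trans_le hcp
  have hB : |∫ x, (Set.Iic a).indicator (likelihood p) x ∂ν| ≤ 1 := by
    rw [abs_of_nonneg (integral_nonneg fun x =>
      Set.indicator_nonneg (fun y _ => (likelihood_pos p y).le) x)]
    refine le_trans ?_ (integral_likelihood_le_one hp.le ν)
    exact integral_mono ((integrable_likelihood hp.le ν).indicator measurableSet_Iic)
      (integrable_likelihood hp.le ν)
      (fun x => Set.indicator_le_self' (fun y _ => (likelihood_pos p y).le) x)
  refine (abs_div_sub_div_le hδ hμ hν hB).trans ?_
  have h1 := abs_integral_likelihood_indicator_sub_le μ ν hc hcp hpP a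
  have h2 := abs_integral_likelihood_sub_le μ ν hc hcp hpP
  calc _ ≤ (1 + ∫ x, envelope c P x) * kolmogorovDist μ ν / δ +
        1 * ((∫ x, envelope c P x) * kolmogorovDist μ ν) / δ ^ 2 := by gcongr
    _ = _ := by ring

/-- Stability of an updating step followed by an approximately constant Gaussian kernel. -/
lemma abs_ratio_gaussian_sub_le (hc : 0 < c) (hcp : c ≤ p) (hpP : p ≤ P) (hδ : 0 < δ)
    (hμ : δ ≤ ∫ x, likelihood p x ∂μ) (hν : δ ≤ ∫ x, likelihood p x ∂ν) (a m : ℝ) {v : NNReal}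
    (hv : v ≠ 0) :
    |(∫ x, likelihood p x * cdf (gaussianReal (m * x) v) a ∂μ) / (∫ x, likelihood p x ∂μ) -
      (∫ x, likelihood p x * cdf (gaussianReal (m * x) v) a ∂ν) / (∫ x, likelihood p x ∂ν)| ≤
      ((∫ x, envelope c P x) / δ + (1 + 4 / c) * (∫ x, envelope c P x) / δ ^ 2) *
        ((√(2 * Real.pi * v))⁻¹ * |m|) * kolmogorovDist μ ν := by
  have hp : 0 < p := hc.trans_le hcp
  set Γ := cdf (gaussianReal 0 v)
  set L := (√(2 * Real.pi * v))⁻¹ * |m| with hL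
  have hL0 : 0 ≤ L := by positivity
  have hΓ : ∀ x, |Γ (a - m * x) - Γ a| ≤ L * |x| := by
    intro x
    refine (abs_cdf_gaussianReal_sub_le 0 hv a (a - m * x)).trans_eq ?_
    rw [show a - m * x - a = -(m * x) by ring, abs_neg, abs_mul, hL]
    ring
  have hΓ1 : ∀ x y, |Γ x - Γ y| ≤ 1 := by
    intro x y
    rw [abs_le]
    constructor <;> linarith [cdf_nonneg (gaussianReal 0 v) x, cdf_nonneg (gaussianReal 0 v) y,
      cdf_le_one (gaussianReal 0 v) x, cdf_le_one (gaussianReal 0 v) y]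
  -- The constant Γ(a) passes through the ratio and cancels. What is left is of order L, hence
  -- proportional to |m|: this is the source of the contraction.
  set f : ℝ → ℝ := fun x => likelihood p x * (Γ (a - m * x) - Γ a) with hf
  have hΓmeas : Measurable fun x => Γ (a - m * x) :=
    (monotone_cdf _).measurable.comp (by fun_prop)
  have hratio : ∀ (π : Measure ℝ) [IsProbabilityMeasure π],
      (∫ x, likelihood p x * cdf (gaussianReal (m * x) v) a ∂π) / (∫ x, likelihood p x ∂π) =
        Γ a + (∫ x, f x ∂π) / (∫ x, likelihood p x ∂π) := by
    intro π _
    have hpos := integral_likelihood_pos hp.le π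
    have hw := integrable_likelihood hp.le π
    have hfi : Integrable f π := by
      refine hw.mul_bdd (c := 1) (hΓmeas.sub_const _).aestronglyMeasurable (.of_forall fun x => ?_)
      exact hΓ1 _ _
    have e : ∀ x, likelihood p x * cdf (gaussianReal (m * x) v) a =
        likelihood p x * Γ a + f x := by
      intro x
      rw [cdf_gaussianReal_eq, hf]
      ring
    simp_rw [e]
    rw [integral_add (hw.mul_const _) hfi, integral_mul_const]
    field_simp
  rw [hratio μ, hratio ν, add_sub_add_left_eq_sub]
  have hB : |∫ x, f x ∂ν| ≤ L * (1 + 4 / c) := by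
    rw [← Real.norm_eq_abs]
    refine (norm_integral_le_of_norm_le_const (C := L * (1 + 4 / c)) (.of_forall fun x => ?_)).trans
      (by simp)
    rw [Real.norm_eq_abs, hf, abs_mul, abs_of_pos (likelihood_pos _ _)]
    have h1 : |x| ≤ 1 + x ^ 2 := by nlinarith [sq_nonneg (|x| - 1), sq_abs x, abs_nonneg x]
    have h0 := likelihood_pos p x
    calc likelihood p x * |Γ (a - m * x) - Γ a| ≤ likelihood p x * (L * (1 + x ^ 2)) := by
          gcongr
          exact (hΓ x).trans (by gcongr)
      _ = L * ((1 + x ^ 2) * likelihood p x) := by ring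
      _ ≤ L * ((1 + x ^ 2) * likelihood c x) := by
          have := likelihood_anti hcp x
          gcongr
      _ ≤ L * ((1 + 4 / c) * likelihood (c / 2) x) := by
          have := one_add_sq_mul_likelihood_le hc x
          gcongr
      _ ≤ L * (1 + 4 / c) := by
          have := likelihood_le_one (by positivity : 0 ≤ c / 2) x
          have : (1 + 4 / c) * likelihood (c / 2) x ≤ 1 + 4 / c :=
            mul_le_of_le_one_right (by positivity) this
          gcongr
  have hderiv : ∀ x, HasDerivAt f (-(p * x * likelihood p x) * (Γ (a - m * x) - Γ a) +
      likelihood p x * (gaussianPDFReal 0 v (a - m * x) * -m)) x := by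
    intro x
    have h1 : HasDerivAt (fun z => a - m * z) (-m) x := by
      simpa using ((hasDerivAt_id x).const_mul m).const_sub a
    exact (hasDerivAt_likelihood p x).mul
      (((hasDerivAt_cdf_gaussianReal 0 hv (a - m * x)).comp x h1).sub_const _)
  have hfdiff : |∫ x, f x ∂μ - ∫ x, f x ∂ν| ≤ (∫ x, L * envelope c P x) * kolmogorovDist μ ν := by
    refine abs_integral_sub_le_of_hasDerivAt μ ν hderiv ((integrable_envelope hc).const_mul L)
      (fun x => ?_) (l := 0) ?_
    · have h0 := likelihood_pos p x
      have hpdf := gaussianPDFReal_nonneg 0 v (a - m * x)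
      refine le_trans ?_ (mul_le_mul_of_nonneg_left (le_envelope hc hcp hpP x) hL0)
      refine (abs_add_le _ _).trans ?_
      have t1 : |-(p * x * likelihood p x) * (Γ (a - m * x) - Γ a)| ≤
          L * (P * x ^ 2 * likelihood p x) := by
        rw [abs_mul, abs_neg, abs_mul, abs_mul, abs_of_pos hp, abs_of_pos h0]
        calc p * |x| * likelihood p x * |Γ (a - m * x) - Γ a|
            ≤ p * |x| * likelihood p x * (L * |x|) := by gcongr; exact hΓ x
          _ = L * (p * |x| ^ 2 * likelihood p x) := by ring
          _ ≤ L * (P * x ^ 2 * likelihood p x) := by rw [sq_abs]; gcongr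
      have t2 : |likelihood p x * (gaussianPDFReal 0 v (a - m * x) * -m)| ≤
          L * likelihood p x := by
        rw [abs_mul, abs_mul, abs_neg, abs_of_pos h0, abs_of_nonneg hpdf, mul_comm, hL]
        gcongr
        exact gaussianPDFReal_le _ _ _
      have hP : 0 < P := hp.trans_le hpP
      -- The slack in P x² + 1 ≤ (1 + P)(1 + x²) is exactly P + x².
      have h3 : 0 ≤ L * ((P + x ^ 2) * likelihood p x) := by positivity
      nlinarith
    · refine squeeze_zero_norm (fun x => ?_) (tendsto_likelihood_atTop hp)
      rw [Real.norm_eq_abs, hf, abs_mul, abs_of_pos (likelihood_pos _ _)]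
      exact mul_le_of_le_one_right (likelihood_pos _ _).le (hΓ1 _ _)
  rw [integral_const_mul] at hfdiff
  have hwdiff := abs_integral_likelihood_sub_le μ ν hc hcp hpP
  refine (abs_div_sub_div_le hδ hμ hν hB).trans ?_
  calc _ ≤ L * (∫ x, envelope c P x) * kolmogorovDist μ ν / δ +
        L * (1 + 4 / c) * ((∫ x, envelope c P x) * kolmogorovDist μ ν) / δ ^ 2 := by gcongr
    _ = _ := by ring

end Ratio

/-! ### Stability of the filtering semigroup -/

lemma likelihood_mul_cdf_gaussianReal_zero_var (p a z : ℝ) :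
    likelihood p z * cdf (gaussianReal z 0) a = (Set.Iic a).indicator (likelihood p) z := by
  rw [gaussianReal_zero_var, cdf_eq_real, measureReal_def,
    Measure.dirac_apply' _ measurableSet_Iic]
  simp only [Set.indicator, Set.mem_Iic, Pi.one_apply]
  split_ifs <;> simp

section Stability

variable {ρ σ c : ℝ}

lemma abs_slope_le (hσ : 0 < σ) (hc : 0 < c) (k : ℕ) :
    |slope ρ (σ ^ 2) c k| ≤
      √((c + ρ ^ 2 / σ ^ 2) / c) * √((1 + c * σ ^ 2)⁻¹) ^ k := by
  have hs : 0 < σ ^ 2 := by positivity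
  have h1 := slope_sq_le (ρ := ρ) hs hc k
  have h2 := precision_le (ρ := ρ) hs hc k
  apply abs_le_of_sq_le_sq _ (by positivity)
  rw [mul_pow, ← pow_mul, mul_comm k 2, pow_mul, Real.sq_sqrt (by positivity),
    Real.sq_sqrt (by positivity), div_mul_eq_mul_div, le_div_iff₀ hc]
  refine h1.trans ?_
  gcongr

/-- Exponential stability of the filtering semigroup in Kolmogorov distance, on the set of
distributions that give a mass bounded from below to a Gaussian function. -/
lemma exists_kolmogorovDist_propagate_le (hσ : 0 < σ) (hc : 0 < c) {δ : ℝ} (hδ : 0 < δ) :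
    ∃ B θ : ℝ, 0 ≤ B ∧ 0 ≤ θ ∧ θ < 1 ∧
      ∀ (k : ℕ) (μ ν : Measure ℝ) [IsProbabilityMeasure μ] [IsProbabilityMeasure ν],
        δ ≤ ∫ x, likelihood (c + ρ ^ 2 / σ ^ 2) x ∂μ →
        δ ≤ ∫ x, likelihood (c + ρ ^ 2 / σ ^ 2) x ∂ν →
        kolmogorovDist (propagate ρ σ c k μ) (propagate ρ σ c k ν) ≤
          B * θ ^ k * kolmogorovDist μ ν := by
  have hs : 0 < σ ^ 2 := by positivity
  set P := c + ρ ^ 2 / σ ^ 2 with hPdef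
  have hP : 0 < P := by positivity
  set J := ∫ x, envelope c P x with hJ
  have hJ0 : 0 ≤ J := integral_nonneg (envelope_nonneg hc hP.le)
  set v₁ := σ ^ 2 / (1 + c * σ ^ 2) with hv₁
  have hv₁0 : 0 < v₁ := by positivity
  set B₀ := (1 + J) / δ + J / δ ^ 2 with hB₀
  set B₁ := (J / δ + (1 + 4 / c) * J / δ ^ 2) * ((√(2 * Real.pi * v₁))⁻¹ * √(P / c)) with hB₁
  have hB₀0 : 0 ≤ B₀ := by positivity
  have hB₁0 : 0 ≤ B₁ := by positivity
  -- `B₀` covers k = 0, where the kernel is a Dirac mass; `B₁` covers k ≥ 1. The rate is that of the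
  -- slope.
  refine ⟨B₀ + B₁, √((1 + c * σ ^ 2)⁻¹), by positivity, by positivity, ?_, ?_⟩
  · rw [Real.sqrt_lt' one_pos, one_pow]
    apply inv_lt_one_of_one_lt₀
    have : 0 < c * σ ^ 2 := by positivity
    linarith
  intro k μ ν _ _ hμ hν
  have hle : ∀ (π : Measure ℝ) [IsProbabilityMeasure π], δ ≤ ∫ x, likelihood P x ∂π →
      δ ≤ ∫ x, likelihood (precision ρ (σ ^ 2) c k) x ∂π := fun π _ h =>
    h.trans (integral_mono (integrable_likelihood hP.le π)
      (integrable_likelihood (precision_pos hs hc k).le π)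
      (likelihood_anti (precision_le hs hc k)))
  have hD := kolmogorovDist_nonneg μ ν
  refine kolmogorovDist_le fun a => ?_
  rw [cdf_propagate hσ hc, cdf_propagate hσ hc]
  cases k with
  | zero =>
    have h := abs_ratio_indicator_sub_le μ ν hc le_rfl (precision_le (ρ := ρ) hs hc 0) hδ
      (hle μ hμ) (hle ν hν) a
    rw [pow_zero, mul_one]
    simp only [slope, spread, precision, one_mul, Real.toNNReal_zero,
      likelihood_mul_cdf_gaussianReal_zero_var] at h ⊢
    refine h.trans (mul_le_mul_of_nonneg_right ?_ hD)
    exact le_add_of_nonneg_right hB₁0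
  | succ k =>
    have hv := le_spread_succ (ρ := ρ) hs hc k
    have hv0 : 0 < spread ρ (σ ^ 2) c (k + 1) := hv₁0.trans_le hv
    have h := abs_ratio_gaussian_sub_le μ ν hc (le_precision (ρ := ρ) hs hc (k + 1))
      (precision_le (ρ := ρ) hs hc (k + 1)) hδ (hle μ hμ) (hle ν hν) a
      (slope ρ (σ ^ 2) c (k + 1)) (v := (spread ρ (σ ^ 2) c (k + 1)).toNNReal)
      (by simpa using hv0)
    refine h.trans (mul_le_mul_of_nonneg_right ?_ hD)
    rw [Real.coe_toNNReal _ hv0.le]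
    have hm := abs_slope_le (ρ := ρ) hσ hc (k + 1)
    calc (J / δ + (1 + 4 / c) * J / δ ^ 2) *
          ((√(2 * Real.pi * spread ρ (σ ^ 2) c (k + 1)))⁻¹ * |slope ρ (σ ^ 2) c (k + 1)|)
        ≤ (J / δ + (1 + 4 / c) * J / δ ^ 2) * ((√(2 * Real.pi * v₁))⁻¹ *
          (√(P / c) * √((1 + c * σ ^ 2)⁻¹) ^ (k + 1))) := by gcongr
      _ = B₁ * √((1 + c * σ ^ 2)⁻¹) ^ (k + 1) := by rw [hB₁]; ring
      _ ≤ (B₀ + B₁) * √((1 + c * σ ^ 2)⁻¹) ^ (k + 1) := by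
        gcongr
        exact le_add_of_nonneg_left hB₀0

/-- Uniform-in-time propagation of errors: local errors of size `e` lead to a global error of
order `e`. -/
lemma exists_kolmogorovDist_propagate_le_of_local (hσ : 0 < σ) (hc : 0 < c) (η₁ : Measure ℝ)
    [IsProbabilityMeasure η₁] :
    ∃ A e₀ : ℝ, 0 ≤ A ∧ 0 < e₀ ∧ ∀ (e : ℝ) (μ ν : ℕ → Measure ℝ),
      (∀ t, IsProbabilityMeasure (μ t)) → ν 0 = η₁ →
      (∀ t, ν (t + 1) = (propagate ρ σ c 0 (μ t)).bind (transition ρ σ)) →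
      (∀ t, kolmogorovDist (μ t) (ν t) ≤ e) → e ≤ e₀ →
      ∀ t, kolmogorovDist (propagate ρ σ c 0 (μ t)) (propagate ρ σ c t η₁) ≤ A * e := by
  have hs : 0 < σ ^ 2 := by positivity
  have hlow := fun k => le_integral_likelihood_propagate (ρ := ρ) hσ hc η₁ k
  have hbind := fun (ν : Measure ℝ) [IsProbabilityMeasure ν] =>
    le_integral_likelihood_bind (ρ := ρ) hσ hc ν
  have hcP : c ≤ c + ρ ^ 2 / σ ^ 2 := le_add_of_nonneg_right (by positivity)
  set P := c + ρ ^ 2 / σ ^ 2 with hPdef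
  have hP : 0 < P := hc.trans_le hcP
  set J := ∫ x, envelope c P x with hJ
  have hJ0 : 0 ≤ J := integral_nonneg (envelope_nonneg hc hP.le)
  set δ₁ := (√(1 + P * c⁻¹))⁻¹ * ∫ z, likelihood (P + P * (P / c)) z ∂η₁ with hδ₁
  have hδ₁0 : 0 < δ₁ := mul_pos (by positivity) (integral_likelihood_pos (by positivity) η₁)
  set γ := (√(1 + P * σ ^ 2))⁻¹ with hγ
  have hγ0 : 0 < γ := by positivity
  have hδ₀0 : 0 < ∫ x, likelihood P x ∂η₁ := integral_likelihood_pos hP.le η₁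
  -- The measures `ν t` will have Gaussian mass at least 2δ: the first entry serves t = 0, the
  -- second a prediction step from mass δ₁/2. The halving leaves room for a local error.
  set δ := min (∫ x, likelihood P x ∂η₁) (γ * (δ₁ / 2)) / 2 with hδ
  have hδ0 : 0 < δ := by positivity
  obtain ⟨B, θ, hB, hθ0, hθ1, hstab⟩ := exists_kolmogorovDist_propagate_le (ρ := ρ) hσ hc hδ0
  have hθ : 0 < 1 - θ := by linarith
  -- The sum of the series of B θ^k, hence the fixed point of A ↦ B + A θ.
  set A := B / (1 - θ) with hA
  have hA0 : 0 ≤ A := by positivity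
  have hBA : B + A * θ = A := by rw [hA]; field_simp; ring
  -- Small enough that J A e ≤ δ₁/2 and J e ≤ δ: neither the global nor the local error destroys the
  -- lower bounds on the masses.
  set e₀ := min (δ₁ / 2) δ / (J * (A + 1) + 1) with he₀
  have he₀0 : 0 < e₀ := by positivity
  have he₀' : J * (A + 1) * e₀ ≤ min (δ₁ / 2) δ := by
    have h1 : (J * (A + 1) + 1) * e₀ = min (δ₁ / 2) δ := by rw [he₀]; field_simp
    linarith
  refine ⟨A, e₀, hA0, he₀0, fun e μ ν hμ hν0 hν hloc hee₀ => ?_⟩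
  have he0 : 0 ≤ e := (kolmogorovDist_nonneg _ _).trans (hloc 0)
  have hprop : ∀ (k : ℕ) (π : Measure ℝ) [IsProbabilityMeasure π],
      IsProbabilityMeasure (propagate ρ σ c k π) := fun k π _ =>
    isProbabilityMeasure_propagate hσ hc π k
  have hJA : J * (A * e) ≤ δ₁ / 2 := by
    have : J * (A * e) ≤ J * (A + 1) * e₀ := by
      rw [← mul_assoc]
      gcongr
      linarith
    exact this.trans (he₀'.trans (min_le_left _ _))
  have hJe : J * e ≤ δ := by
    have : J * e ≤ J * (A + 1) * e₀ := by
      gcongr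
      exact le_mul_of_one_le_right hJ0 (by linarith)
    exact this.trans (he₀'.trans (min_le_right _ _))
  have hνprob : ∀ t, IsProbabilityMeasure (ν t) := by
    intro t
    cases t with
    | zero => rw [hν0]; infer_instance
    | succ t =>
      rw [hν]
      have := hprop 0 (μ t)
      infer_instance
  have hμlow : ∀ t, 2 * δ ≤ ∫ x, likelihood P x ∂ν t → δ ≤ ∫ x, likelihood P x ∂μ t := by
    intro t ht
    have h1 := abs_integral_likelihood_sub_le (μ t) (ν t) hc hcP le_rfl
    have h2 := mul_le_mul_of_nonneg_left (hloc t) hJ0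
    have h3 := (abs_le.1 h1).1
    linarith
  -- The induction on t needs every look-ahead k: the factor θ^k is what keeps the accumulated error
  -- bounded.
  have key : ∀ t k : ℕ, kolmogorovDist (propagate ρ σ c k (μ t)) (propagate ρ σ c (k + t) η₁) ≤
      A * θ ^ k * e := by
    intro t
    induction t with
    | zero =>
      intro k
      have hlow0 : 2 * δ ≤ ∫ x, likelihood P x ∂ν 0 := by
        rw [hν0, hδ, mul_div_cancel₀ _ two_ne_zero]
        exact min_le_left _ _
      have h1 := hstab k (μ 0) (ν 0) (hμlow 0 hlow0) (by linarith)
      have hle : B ≤ A := by nlinarith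
      rw [hν0] at h1
      refine h1.trans ?_
      have := hν0 ▸ hloc 0
      have := kolmogorovDist_nonneg (μ 0) η₁
      gcongr
    | succ t ih =>
      intro k
      -- Bootstrap: the error bound at time t, with k = 0, transfers the mass bound of the exact
      -- filter to its approximation.
      have hest : δ₁ / 2 ≤ ∫ x, likelihood P x ∂propagate ρ σ c 0 (μ t) := by
        have := hprop 0 (μ t)
        have := hprop t η₁
        have h0 := ih 0
        rw [zero_add, pow_zero, mul_one] at h0
        have h1 := abs_integral_likelihood_sub_le (propagate ρ σ c 0 (μ t)) (propagate ρ σ c t η₁)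
          hc hcP le_rfl
        have h2 := mul_le_mul_of_nonneg_left h0 hJ0
        have h3 := (abs_le.1 h1).1
        have h4 := hlow t
        linarith
      have hνlow : 2 * δ ≤ ∫ x, likelihood P x ∂ν (t + 1) := by
        have := hprop 0 (μ t)
        rw [hδ, mul_div_cancel₀ _ two_ne_zero, hν]
        refine (min_le_right _ _).trans (le_trans ?_ (hbind _))
        gcongr
      have h1 := hstab k (μ (t + 1)) (ν (t + 1)) (hμlow _ hνlow) (by linarith)
      have h2 := ih (k + 1)
      -- Looking k + 1 steps ahead from `μ t` is looking k steps ahead from `ν (t + 1)`: old errors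
      -- gain a factor θ, and one new local error is added.
      rw [← propagate_bind_transition hc, ← hν, add_right_comm, add_assoc] at h2
      have h3 : B * θ ^ k * kolmogorovDist (μ (t + 1)) (ν (t + 1)) ≤ B * θ ^ k * e := by
        have := hloc (t + 1)
        gcongr
      calc _ ≤ B * θ ^ k * e + A * θ ^ (k + 1) * e :=
            (kolmogorovDist_triangle _ _ _).trans (add_le_add (h1.trans h3) h2)
        _ = (B + A * θ) * θ ^ k * e := by ring
        _ = A * θ ^ k * e := by rw [hBA]
  intro t
  simpa using key t 0

end Stability

/-! ### Uniform-in-time error bounds for the algorithm -/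

lemma exists_kolmogorovDist_particle_le (ρ : ℝ) {σ c : ℝ} (hσ : 0 < σ) (hc : 0 < c)
    (η₁ : Measure ℝ) [IsProbabilityMeasure η₁] :
    ∃ A e₀ : ℝ, 0 ≤ A ∧ 0 < e₀ ∧ ∀ (N : ℕ), 1 ≤ N → 12 / √N ≤ e₀ →
      ∀ u : ℕ → ℕ → Fin 2 → ℝ, (∀ t, IsTSSequence 0 2 2 (u t)) →
        (∀ t n j, u t n j ∈ Set.Ioo (0 : ℝ) 1) → ∀ t,
          kolmogorovDist (filterEst ρ σ c η₁ (fun t (n : Fin N) => u t n) t)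
            (filterDist ρ σ c η₁ t) ≤ (A + 1) * (12 / √N) ∧
          kolmogorovDist (predEst ρ σ c η₁ (fun t (n : Fin N) => u t n) t)
            (predDist ρ σ c η₁ t) ≤ (A + 1) * (12 / √N) := by
  obtain ⟨A, e₀, hA, he₀, h⟩ := exists_kolmogorovDist_propagate_le_of_local (ρ := ρ) hσ hc η₁
  refine ⟨A, e₀, hA, he₀, fun N hN hNe u hu h01 => ?_⟩
  set v : ℕ → Fin N → Fin 2 → ℝ := fun t n => u t n with hv
  have hprob : ∀ t, IsProbabilityMeasure (predEst ρ σ c η₁ v t) := fun t =>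
    isProbabilityMeasure_empirical hN _
  have hfilt : ∀ t, filterEst ρ σ c η₁ v t = propagate ρ σ c 0 (predEst ρ σ c η₁ v t) := fun t =>
    weightedEmpirical_eq_propagate ρ σ c hN _
  have hfprob : ∀ t, IsProbabilityMeasure (filterEst ρ σ c η₁ v t) := fun t => by
    rw [hfilt]
    exact isProbabilityMeasure_propagate hσ hc _ 0
  have hdprob : ∀ t, IsProbabilityMeasure (filterDist ρ σ c η₁ t) := fun t => by
    rw [filterDist_eq_propagate hc]
    exact isProbabilityMeasure_propagate hσ hc _ t
  -- `ν t` is the law that the sampling step at index t approximates, so its distance to the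
  -- empirical measure is the local error.
  set ν : ℕ → Measure ℝ := fun t =>
    Nat.casesOn t η₁ fun t => (filterEst ρ σ c η₁ v t).bind (transition ρ σ) with hν
  have hloc : ∀ t, kolmogorovDist (predEst ρ σ c η₁ v t) (ν t) ≤ 12 / √N := by
    intro t
    cases t with
    | zero => exact kolmogorovDist_empirical_quantile_le (hu 0) (h01 0) hN η₁
    | succ t =>
      exact kolmogorovDist_empirical_transition_le (hu (t + 1)) (h01 (t + 1)) hN ρ σ
        (filterEst ρ σ c η₁ v t)
  have he : 0 ≤ 12 / √(N : ℝ) := by positivity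
  have hF : ∀ t, kolmogorovDist (filterEst ρ σ c η₁ v t) (filterDist ρ σ c η₁ t) ≤
      A * (12 / √N) := by
    intro t
    rw [hfilt, filterDist_eq_propagate hc]
    exact h _ (predEst ρ σ c η₁ v) ν hprob rfl (fun t => by rw [← hfilt]) hloc hNe t
  refine fun t => ⟨(hF t).trans (by gcongr; linarith), ?_⟩
  cases t with
  | zero =>
    refine (hloc 0).trans ?_
    exact le_mul_of_one_le_left he (by linarith)
  | succ t =>
    refine (kolmogorovDist_triangle _ (ν (t + 1)) _).trans ?_
    have h2 := (kolmogorovDist_bind_transition_le ρ hσ (filterEst ρ σ c η₁ v t)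
      (filterDist ρ σ c η₁ t)).trans (hF t)
    have h1 := hloc (t + 1)
    calc _ ≤ 12 / √N + A * (12 / √N) := add_le_add h1 h2
      _ = _ := by ring

/-- Removes the logarithms: log(1 + N) ≥ log 2 ≥ 1/2, whose square accounts for the factor 4, and K
≥ 1. -/
lemma le_of_div_log_sq_ge {C K κ : ℝ} {N : ℕ} (hN : 1 ≤ N) (hC : 0 ≤ C) (hK : 1 ≤ K)
    (h : (N : ℝ) / Real.log (1 + N) ^ 2 ≥ 4 * C * K ^ 2 * κ⁻¹ ^ 2) : C * κ⁻¹ ^ 2 ≤ N := by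
  have hN1 : (1 : ℝ) ≤ N := by exact_mod_cast hN
  have hlog : 1 / 2 ≤ Real.log (1 + N) := by
    have h1 : Real.log 2 ≤ Real.log (1 + N) := Real.log_le_log (by norm_num) (by linarith)
    linarith [Real.log_two_gt_d9]
  have hL : 1 / 4 ≤ Real.log (1 + N) ^ 2 := by nlinarith
  have hX : 0 ≤ C * κ⁻¹ ^ 2 := by positivity
  have hK2 : 1 ≤ K ^ 2 := one_le_pow₀ hK
  rw [ge_iff_le, le_div_iff₀ (by linarith)] at h
  calc C * κ⁻¹ ^ 2 = 4 * (C * κ⁻¹ ^ 2) * 1 * (1 / 4) := by ring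
    _ ≤ 4 * (C * κ⁻¹ ^ 2) * K ^ 2 * Real.log (1 + N) ^ 2 := by gcongr
    _ = 4 * C * K ^ 2 * κ⁻¹ ^ 2 * Real.log (1 + N) ^ 2 := by ring
    _ ≤ N := h

end SQMC

end

/-! ### The almost sure bound, uniform in time. -/

theorem corollary2 (ρ σ c : ℝ) (hσ : 0 < σ) (hc : 0 < c)
    (η₁ : Measure ℝ) [IsProbabilityMeasure η₁] :
    ∃ C : ℝ, 0 < C ∧
      ∀ (N : ℕ), 1 ≤ N →
      ∀ (Ω : Type*) [MeasurableSpace Ω] (P : Measure Ω) [IsProbabilityMeasure P]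
        (U : ℕ → ℕ → Ω → Fin 2 → ℝ), (∀ t, SQMC.IsScrambledSequence P 0 2 2 (U t)) →
      ∀ κ : ℝ, 0 < κ → κ < 1 →
        (N : ℝ) / Real.log (1 + N) ^ 2 ≥ C * (1 + Real.log (1 + κ⁻¹)) ^ 2 * (κ⁻¹) ^ 2 →
        ∀ᵐ ω ∂P,
          (⨆ t : ℕ, SQMC.kolmogorovDist
            (SQMC.filterEst ρ σ c η₁ (fun t (n : Fin N) => U t n ω) t)
            (SQMC.filterDist ρ σ c η₁ t)) ≤ κ ∧
          (⨆ t : ℕ, SQMC.kolmogorovDist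
            (SQMC.predEst ρ σ c η₁ (fun t (n : Fin N) => U t n ω) t)
            (SQMC.predDist ρ σ c η₁ t)) ≤ κ := by
  obtain ⟨A, e₀, hA, he₀, h⟩ := SQMC.exists_kolmogorovDist_particle_le ρ hσ hc η₁
  -- The first square gives (A + 1) · 12/√N ≤ κ; the second gives 12/√N ≤ e₀, using κ < 1.
  refine ⟨4 * ((12 * (A + 1)) ^ 2 + (12 / e₀) ^ 2), by positivity, ?_⟩
  intro N hN Ω _ P _ U hU κ hκ hκ1 hcond
  have hN0 : (0 : ℝ) < √N := by
    rw [Real.sqrt_pos]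
    exact_mod_cast hN
  have hκinv : 1 ≤ κ⁻¹ := (one_le_inv₀ hκ).2 hκ1.le
  have hle := SQMC.le_of_div_log_sq_ge hN (by positivity)
    (le_add_of_nonneg_right (Real.log_nonneg (by linarith))) hcond
  have h1 : 12 * (A + 1) * κ⁻¹ ≤ √N := by
    apply Real.le_sqrt_of_sq_le
    rw [mul_pow]
    refine le_trans ?_ hle
    gcongr
    exact le_add_of_nonneg_right (by positivity)
  have h2 : 12 / e₀ ≤ √N := by
    apply Real.le_sqrt_of_sq_le
    refine le_trans ?_ hle
    have h3 : (1 : ℝ) ≤ κ⁻¹ ^ 2 := one_le_pow₀ hκinv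
    calc (12 / e₀) ^ 2 ≤ ((12 * (A + 1)) ^ 2 + (12 / e₀) ^ 2) * 1 := by
          rw [mul_one]
          exact le_add_of_nonneg_left (by positivity)
      _ ≤ _ := by gcongr
  have hbound : (A + 1) * (12 / √N) ≤ κ := by
    rw [← mul_div_assoc, div_le_iff₀ hN0]
    rw [← div_eq_mul_inv, div_le_iff₀ hκ] at h1
    linarith
  have hsmall : 12 / √N ≤ e₀ := by
    rw [div_le_iff₀ hN0]
    rw [div_le_iff₀ he₀] at h2
    linarith
  filter_upwards [ae_all_iff.2 fun t => (hU t).ae_isTSSequence] with ω hω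
  have key := h N hN hsmall (fun t n => U t n ω) hω fun t n j => (hU t).mem_Ioo n ω j
  exact ⟨ciSup_le fun t => (key t).1.trans hbound, ciSup_le fun t => (key t).2.trans hbound⟩
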